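/- **Setting.** A Markov decision process (MDP) $\mathcal M=(S,\mathsf{AP},L,\mathit{Act},\mathbf P)$ has finite non-empty sets $S$ of states and $\mathit{Act}$ of actions, a labeling $L:S\to 2^{\mathsf{AP}}$, and $\mathbf P:S\times\mathit{Act}\times S\to[0,1]$ such that each $\sum_{s'}\mathbf P(s,\alpha,s')$ is $0$ or $1$, and for each $s$ it is $1$ for at least one $\alpha$; such $\alpha$ are *enabled* in $s$. A *scheduler* $\sigma$ has a countable set $Q$ of modes, $\mathit{mode}:Q\times S\to Q$, $\mathit{init}:S\to Q$, and picks in $(q,s)$ an enabled action at random with probabilities $\mathit{act}(q,s,\cdot)$. A *stutter-scheduler* $\tau$ has a countable set $Q^\varepsilon$ of modes, $\mathit{mode}^\varepsilon:Q^\varepsilon\times S\times\mathit{Act}\to Q^\varepsilon$, $\mathit{init}^\varepsilon:S\to Q^\varepsilon$, and for each $(q^\varepsilon,s,\alpha)$ a probability of stuttering. The Markov chain $\mathcal M^\sigma$ on $Q\times S$ is the usual one induced by $\sigma$. The Markov chain $\mathcal M^{\sigma,\tau}$ on $Q\times Q^\varepsilon\times S$ works as follows: in $(q,q^\varepsilon,s)$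 an action $\alpha$ is chosen by $\sigma$, then $\tau$ chooses to stutter or to proceed, and $q^\varepsilon$ becomes $\mathit{mode}^\varepsilon(q^\varepsilon,s,\alpha)$; when stuttering, $q$ and $s$ stay the same, and when proceeding, $q$ becomes $\mathit{mode}(q,s)$ and $s$ moves according to $\mathbf P(s,\alpha,\cdot)$. $\tau$ is *fair* for $\sigma$ if from each initial state infinitely many consecutive stuttering steps have probability $0$. **Logics.** Fix a set of arithmetic operators $f$ on real numbers. Non-quantified formulas are given by $\psi::=\mathtt{true}\mid a_v\mid\psi\wedge\psi\mid\neg\psi\mid p\sim p$ with $p::=\mathbb P(\bigcirc\psi)\mid\mathbb P(\psi\,\mathcal U\,\psi)\mid f(p,\dots,p)$, $a\in\mathsf{AP}$ and ${\sim}\in\{\le,<,=,\ne,>,\ge\}$. A *HyperPCTL* formula is a sequence of scheduler quantifiers $\forall\hat\sigma,\exists\hat\sigma$, followed by state quantifiers $\forall\hat s(\hat\sigma),\exists\hat s(\hat\sigma)$, followed by a non-quantified formula with atoms $a_{\hat s}$; the latter is evaluated in the product of the chains $\mathcal M^{\sigma_i}$, one for each state variable, started in the chosen states with their initial modes. An *AHyperPCTL*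 formula has in addition, after the state quantifiers, stutter quantifiers $\forall\hat\tau(\hat s),\exists\hat\tau(\hat s)$, which range over the stutter-schedulers that are fair for the scheduler of $\hat s$, and its atoms are $a_{\hat\tau}$; the non-quantified formula is evaluated in the product of the chains $\mathcal M^{\sigma_i,\tau_i}$, one for each stutter-scheduler variable. All variables are bound. **The MDP $\mathcal M'$.** The states of $\mathcal M'$ are the states $s$ of $\mathcal M$ and a copy $s^\circ$ of each state $s$ that has a self-loop ($\mathbf P(s,\alpha,s)>0$ for some $\alpha$). The self-loop is replaced by a loop $s\to s^\circ\to s$ with the same probabilities $\mathbf P(s,\alpha,s)$; every transition from $s$ to $t\neq s$ is kept and added from $s^\circ$ to $t$ with the same probability. $s$ and $s^\circ$ keep the labels of $s$, and each state $x$ of $\mathcal M'$ gets a unique additional label $a_x$. Let $\mathit{trivial}_{\hat\tau_1,\dots,\hat\tau_l}$ be the formula $\mathbb P\big(\Box\bigwedge_{i}\bigwedge_{x}\big((a_x)_{\hat\tau_i}\Rightarrow\mathbb P(\bigcirc (a_x)_{\hat\tau_i})=0\big)\big)=1$. **Lemma (AHyperPCTL is strictly more expressive than HyperPCTL).** 1.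 *(At least as expressive.)* For every finite non-empty set $S$ and every HyperPCTL formula $\varphi$ over $\mathsf{AP}$ with state variables $\hat s_1,\dots,\hat s_l$ there is a non-quantified formula $\chi$, depending only on $S$ and $\varphi$, such that the AHyperPCTL formula $\varphi'$ that consists of the scheduler and state quantifiers of $\varphi$ followed by $\forall\hat\tau_1(\hat s_1)\dots\forall\hat\tau_l(\hat s_l).\,(\mathit{trivial}_{\hat\tau_1,\dots,\hat\tau_l}\Rightarrow\chi)$ satisfies, for every MDP $\mathcal M$ with state set $S$, $$\mathcal M\models\varphi\iff\mathcal M'\models\varphi'.$$ 2. *(Strictness.)* If $\mathsf{AP}\ne\emptyset$, there are a finite non-empty set $S$ and an AHyperPCTL formula $\psi$ over $\mathsf{AP}$ such that no HyperPCTL formula $\varphi$ over $\mathsf{AP}$ satisfies $\mathcal M\models\psi\iff\mathcal M\models\varphi$ for all MDPs $\mathcal M$ with state set $S$, and no HyperPCTL formula $\varphi$ over the extended set of labels satisfies $\mathcal M\models\psi\iff\mathcal M'\models\varphi$ for all MDPs $\mathcal M$ with state set $S$. -/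

import Mathlib

open MeasureTheory ProbabilityTheory
open scoped NNReal ENNReal

namespace HyperLogic

/-! ### Discrete-time Markov chains -/

/-- A discrete-time Markov chain over a countable state space; the transition probability
`P(x, y)` is `step x y`. -/
structure DTMC (AP : Type) where
  State : Type
  countable : Countable State
  label : State → Set AP
  step : State → PMF State

namespace DTMC

variable {AP : Type}

instance (D : DTMC AP) : Countable D.State := D.countable
instance (D : DTMC AP) : MeasurableSpace D.State := ⊤
instance (D : DTMC AP) : DiscreteMeasurableSpace D.State := ⟨fun _ => trivial⟩

/-- The transition function as a Markov kernel from histories `x₀ … xₙ` to the next state. -/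
noncomputable def kernel (D : DTMC AP) (n : ℕ) :
    Kernel ((i : Finset.Iic n) → (fun _ : ℕ => D.State) i) D.State where
  toFun h := (D.step (h ⟨n, Finset.mem_Iic.2 le_rfl⟩)).toMeasure
  measurable' :=
    (Measurable.of_discrete (f := fun x : D.State => (D.step x).toMeasure)).comp
      (measurable_pi_apply _)

instance (D : DTMC AP) (n : ℕ) : IsMarkovKernel (D.kernel n) :=
  ⟨fun h => inferInstanceAs
    (IsProbabilityMeasure (D.step (h ⟨n, Finset.mem_Iic.2 le_rfl⟩)).toMeasure)⟩

/-- The probability measure on infinite state sequences that start in `x` (sequences that use a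
transition of probability `0` form a null set). -/
noncomputable def pathMeasure (D : DTMC AP) (x : D.State) : Measure (ℕ → D.State) :=
  Kernel.traj (X := fun _ : ℕ => D.State) D.kernel 0 (fun _ => x)

/-- The composition of `n` Markov chains: the product chain, in which the atomic proposition `a`
of the `i`-th chain is written `(a, i)`. -/
noncomputable def compose {n : ℕ} (D : Fin n → DTMC AP) : DTMC (AP × Fin n) where
  State := ∀ i, (D i).State
  countable := inferInstance
  label x := {p | p.1 ∈ (D p.2).label (x p.2)}
  step x := ⟨fun y => ∏ i, (D i).step (x i) (y i), by
    have h : ∑' y : ∀ i, (D i).State, ∏ i, (D i).step (x i) (y i) = 1 := by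
      have h1 : ∀ y : ∀ i, (D i).State, ∏ i, (D i).step (x i) (y i)
          = Measure.pi (fun i => ((D i).step (x i)).toMeasure) {y} := fun y => by
        rw [Measure.pi_singleton]
        exact Finset.prod_congr rfl fun i _ =>
          (PMF.toMeasure_apply_singleton _ _ (MeasurableSet.singleton _)).symm
      simp_rw [h1]
      rw [← measure_univ (μ := Measure.pi (fun i => ((D i).step (x i)).toMeasure)),
        ← Set.biUnion_of_singleton (Set.univ : Set (∀ i, (D i).State)),
        measure_biUnion (Set.to_countable _) (fun a _ b _ hab => by simpa using hab)
          (fun y _ => MeasurableSet.singleton y),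
        tsum_univ (fun y => Measure.pi (fun i => ((D i).step (x i)).toMeasure) {y})]
    exact h ▸ ENNReal.summable.hasSum⟩

end DTMC

/-! ### Markov decision processes and schedulers -/

/-- A Markov decision process with finite sets of states and actions. -/
structure MDP (AP S Act : Type) [Fintype S] [Fintype Act] where
  label : S → Set AP
  P : S → Act → S → ℝ≥0
  exists_enabled : ∀ s, ∃ α, ∑ s', P s α s' = 1
  enabled_or_disabled : ∀ s α, ∑ s', P s α s' = 1 ∨ ∑ s', P s α s' = 0

section

variable {AP S Act : Type} [Fintype S] [Fintype Act]

/-- The set of actions enabled in `s`. -/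
def MDP.enabled (M : MDP AP S Act) (s : S) : Set Act := {α | ∑ s', M.P s α s' = 1}

/-- A (probabilistic, history-dependent) scheduler with a countable set `Q` of modes. -/
structure Scheduler (M : MDP AP S Act) where
  Q : Type
  countable : Countable Q
  nonempty : Nonempty Q
  mode : Q → S → Q
  init : S → Q
  act : Q → S → Act → ℝ≥0
  sum_act : ∀ q s, ∑ α, act q s α = 1
  act_disabled : ∀ q s α, α ∉ M.enabled s → act q s α = 0

/-- The two choices of a stutter-scheduler. -/
inductive Choice where
  | stutter
  | proceed
  deriving DecidableEq

instance : Fintype Choice := ⟨{.stutter, .proceed}, by rintro (_ | _) <;> simp⟩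

/-- A stutter-scheduler with a countable set `Q` of modes. -/
structure StutterScheduler (M : MDP AP S Act) where
  Q : Type
  countable : Countable Q
  nonempty : Nonempty Q
  mode : Q → S → Act → Q
  init : S → Q
  act : Q → S → Act → Choice → ℝ≥0
  sum_act : ∀ q s α, act q s α .stutter + act q s α .proceed = 1

end

namespace MDP

variable {AP S Act : Type} [Fintype S] [Fintype Act] (M : MDP AP S Act)

instance (σ : Scheduler M) : Countable σ.Q := σ.countable
instance (τ : StutterScheduler M) : Countable τ.Q := τ.countable

theorem sum_act_mul_P (σ : Scheduler M) (q : σ.Q) (s : S) (w : Act → ℝ≥0) :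
    ∑ s', ∑ α, σ.act q s α * w α * M.P s α s' = ∑ α, σ.act q s α * w α := by
  rw [Finset.sum_comm]
  refine Finset.sum_congr rfl fun α _ => ?_
  rw [← Finset.mul_sum]
  by_cases h : α ∈ M.enabled s
  · rw [show ∑ s', M.P s α s' = 1 from h, mul_one]
  · rw [σ.act_disabled q s α h]; simp

open Classical in
/-- The Markov chain `M^σ` on `Q × S` induced by a scheduler `σ` (without stuttering). -/
noncomputable def inducedSync (σ : Scheduler M) : DTMC AP where
  State := σ.Q × S
  countable := inferInstance
  label x := M.label x.2
  step x := ⟨fun y => if y.1 = σ.mode x.1 x.2 then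
      ((∑ α, σ.act x.1 x.2 α * M.P x.2 α y.2 : ℝ≥0) : ℝ≥0∞) else 0, by
    have h : ∑' y : σ.Q × S, (if y.1 = σ.mode x.1 x.2 then
        ((∑ α, σ.act x.1 x.2 α * M.P x.2 α y.2 : ℝ≥0) : ℝ≥0∞) else 0) = 1 := by
      rw [ENNReal.tsum_prod', tsum_eq_single (σ.mode x.1 x.2) (fun q hq => by simp [hq])]
      have h1 := M.sum_act_mul_P σ x.1 x.2 (fun _ => 1)
      simp only [mul_one, σ.sum_act] at h1
      simp only [if_true]
      rw [tsum_fintype, ← ENNReal.ofNNReal_finsetSum, h1, ENNReal.coe_one]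
    exact h ▸ ENNReal.summable.hasSum⟩

/-- The states `Q × Q^ε × S` of the chain induced by a scheduler and a stutter-scheduler. -/
abbrev Config {M : MDP AP S Act} (σ : Scheduler M) (τ : StutterScheduler M) : Type :=
  σ.Q × τ.Q × S

open Classical in
/-- `stut`: the probability of choosing to stutter in `x` while the stutter-mode becomes `e'`. -/
noncomputable def stut {M : MDP AP S Act} (σ : Scheduler M) (τ : StutterScheduler M)
    (x : Config σ τ) (e' : τ.Q) : ℝ≥0 :=
  ∑ α with τ.mode x.2.1 x.2.2 α = e',
    σ.act x.1 x.2.2 α * τ.act x.2.1 x.2.2 α .stutter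

open Classical in
/-- `cont`: the probability of proceeding from `x` to `s'` while the stutter-mode becomes `e'`. -/
noncomputable def cont {M : MDP AP S Act} (σ : Scheduler M) (τ : StutterScheduler M)
    (x : Config σ τ) (e' : τ.Q) (s' : S) : ℝ≥0 :=
  ∑ α with τ.mode x.2.1 x.2.2 α = e',
    σ.act x.1 x.2.2 α * τ.act x.2.1 x.2.2 α .proceed * M.P x.2.2 α s'

open Classical in
/-- The probability that a step from `x` is of the kind `c` (stutter or proceed) and leads to `y`.
A stuttering step keeps the mode of the scheduler and the state; a proceeding step updates the
mode of the scheduler. -/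
noncomputable def jointWeight {M : MDP AP S Act} (σ : Scheduler M) (τ : StutterScheduler M)
    (x : Config σ τ) : Choice × Config σ τ → ℝ≥0
  | (.stutter, y) => if y.1 = x.1 ∧ y.2.2 = x.2.2 then stut σ τ x y.2.1 else 0
  | (.proceed, y) => if y.1 = σ.mode x.1 x.2.2 then cont σ τ x y.2.1 y.2.2 else 0

open Classical in
theorem tsum_fiber {E : Type} (m : Act → E) (w : Act → ℝ≥0) :
    ∑' e, ((∑ α with m α = e, w α : ℝ≥0) : ℝ≥0∞) = ((∑ α, w α : ℝ≥0) : ℝ≥0∞) := by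
  simp only [Finset.sum_filter, ENNReal.ofNNReal_finsetSum]
  rw [Summable.tsum_finsetSum (fun _ _ => ENNReal.summable)]
  refine Finset.sum_congr rfl fun α _ => ?_
  rw [tsum_eq_single (m α) (fun e he => by simp [Ne.symm he])]
  simp

theorem tsum_jointWeight {M : MDP AP S Act} (σ : Scheduler M) (τ : StutterScheduler M)
    (x : Config σ τ) : ∑' p, (jointWeight σ τ x p : ℝ≥0∞) = 1 := by
  classical
  obtain ⟨q, e, s⟩ := x
  have h1 : ∑' y : Config σ τ, (jointWeight σ τ (q, e, s) (.stutter, y) : ℝ≥0∞)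
      = ((∑ α, σ.act q s α * τ.act e s α .stutter : ℝ≥0) : ℝ≥0∞) := by
    rw [ENNReal.tsum_prod', tsum_eq_single q (fun q' h => by simp [jointWeight, h]),
      ENNReal.tsum_prod', ← tsum_fiber (τ.mode e s)]
    refine tsum_congr fun e' => ?_
    rw [tsum_eq_single s (fun s' h => by simp [jointWeight, h])]
    simp [jointWeight, stut]
  have h2 : ∑' y : Config σ τ, (jointWeight σ τ (q, e, s) (.proceed, y) : ℝ≥0∞)
      = ((∑ α, σ.act q s α * τ.act e s α .proceed : ℝ≥0) : ℝ≥0∞) := by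
    rw [ENNReal.tsum_prod', tsum_eq_single (σ.mode q s) (fun q' h => by simp [jointWeight, h]),
      ENNReal.tsum_prod', ← M.sum_act_mul_P σ q s (fun α => τ.act e s α .proceed),
      ENNReal.tsum_comm, tsum_fintype, ENNReal.ofNNReal_finsetSum]
    refine Finset.sum_congr rfl fun s' _ => ?_
    rw [← tsum_fiber (τ.mode e s)]
    refine tsum_congr fun e' => ?_
    simp [jointWeight, cont]
  rw [ENNReal.tsum_prod', tsum_fintype]
  have h3 : (Finset.univ : Finset Choice) = {.stutter, .proceed} := rfl
  rw [h3, Finset.sum_pair (by decide), h1, h2, ← ENNReal.coe_add, ← Finset.sum_add_distrib]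
  simp only [← mul_add, τ.sum_act, mul_one, σ.sum_act, ENNReal.coe_one]

/-- One step from `x`, together with its kind. -/
noncomputable def jointStep {M : MDP AP S Act} (σ : Scheduler M) (τ : StutterScheduler M)
    (x : Config σ τ) : PMF (Choice × Config σ τ) :=
  ⟨fun p => (jointWeight σ τ x p : ℝ≥0∞), tsum_jointWeight σ τ x ▸ ENNReal.summable.hasSum⟩

/-- The Markov chain `M^{σ,τ}` on `Q × Q^ε × S` induced by a scheduler and a stutter-scheduler. -/
noncomputable def induced (σ : Scheduler M) (τ : StutterScheduler M) : DTMC AP where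
  State := Config σ τ
  countable := inferInstance
  label x := M.label x.2.2
  step x := (jointStep σ τ x).map Prod.snd

open Classical in
/-- The transition probabilities of `M^{σ,τ}` by cases. -/
theorem induced_step_apply (σ : Scheduler M) (τ : StutterScheduler M) (q q' : σ.Q)
    (e e' : τ.Q) (s s' : S) :
    (M.induced σ τ).step (q, e, s) (q', e', s') =
      ((if q' = q ∧ q ≠ σ.mode q s ∧ s' = s then stut σ τ (q, e, s) e'
        else if q' = σ.mode q s ∧ (q' ≠ q ∨ s' ≠ s) then cont σ τ (q, e, s) e' s'
        else if q' = q ∧ q = σ.mode q s ∧ s' = s then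
          stut σ τ (q, e, s) e' + cont σ τ (q, e, s) e' s'
        else 0 : ℝ≥0) : ℝ≥0∞) := by
  have h3 : (Finset.univ : Finset Choice) = {.stutter, .proceed} := rfl
  have h : (M.induced σ τ).step (q, e, s) (q', e', s')
      = ((jointWeight σ τ (q, e, s) (.stutter, (q', e', s'))
        + jointWeight σ τ (q, e, s) (.proceed, (q', e', s')) : ℝ≥0) : ℝ≥0∞) := by
    change (PMF.map Prod.snd (jointStep σ τ (q, e, s))) (q', e', s') = _
    rw [PMF.map_apply, ENNReal.tsum_prod', tsum_fintype, h3, Finset.sum_pair (by decide),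
      ENNReal.coe_add]
    congr 1
    · exact (tsum_eq_single (q', e', s') (fun y hy => if_neg (Ne.symm hy))).trans (if_pos rfl)
    · exact (tsum_eq_single (q', e', s') (fun y hy => if_neg (Ne.symm hy))).trans (if_pos rfl)
  rw [h]
  congr 1
  simp only [jointWeight]
  by_cases h1 : q' = q <;> by_cases h2 : s' = s <;> by_cases h4 : q' = σ.mode q s <;>
    grind

/-- The chain `M^{σ,τ}` in which every state also records whether the last step was a stuttering
step. -/
noncomputable def recorded (σ : Scheduler M) (τ : StutterScheduler M) : DTMC AP where
  State := Choice × Config σ τ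
  countable := inferInstance
  label x := M.label x.2.2.2
  step x := jointStep σ τ x.2

end MDP

/-- `τ` is fair for `σ`: from every initial state, the probability of taking infinitely many
consecutive stuttering steps is `0`. -/
def StutterScheduler.Fair {AP S Act : Type} [Fintype S] [Fintype Act] {M : MDP AP S Act}
    (τ : StutterScheduler M) (σ : Scheduler M) : Prop :=
  ∀ s, (M.recorded σ τ).pathMeasure (.proceed, (σ.init s, τ.init s, s))
    {π | ∃ N, ∀ n ≥ N, (π n).1 = Choice.stutter} = 0

/-! ### Non-quantified formulas -/

/-- A family of admissible arithmetic operators over probabilities: `Ops k` is the set of those of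
arity `k` (constants have arity `0`). Operators are applied to values of probability expressions, which
need not lie in `[0, 1]` when operators are nested; hence the domain `ℝ`. -/
abbrev Operators : Type := (k : ℕ) → Set ((Fin k → ℝ) → ℝ)

/-- Comparison symbols. -/
inductive Cmp where
  | le
  | lt
  | eq
  | ne
  | gt
  | ge

def Cmp.eval : Cmp → ℝ → ℝ → Prop
  | .le, x, y => x ≤ y
  | .lt, x, y => x < y
  | .eq, x, y => x = y
  | .ne, x, y => x ≠ y
  | .gt, x, y => x > y
  | .ge, x, y => x ≥ y

mutual

/-- Non-quantified formulas over a set `A` of atoms. -/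
inductive Fml (Ops : Operators) (A : Type) : Type
  | tru : Fml Ops A
  | atom : A → Fml Ops A
  | and : Fml Ops A → Fml Ops A → Fml Ops A
  | neg : Fml Ops A → Fml Ops A
  | cmp : Cmp → ProbExpr Ops A → ProbExpr Ops A → Fml Ops A

/-- Probability expressions. -/
inductive ProbExpr (Ops : Operators) (A : Type) : Type
  | prob : PathFml Ops A → ProbExpr Ops A
  | op : {k : ℕ} → (f : (Fin k → ℝ) → ℝ) → f ∈ Ops k → (Fin k → ProbExpr Ops A) → ProbExpr Ops A

/-- Path formulas. -/
inductive PathFml (Ops : Operators) (A : Type) : Type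
  | next : Fml Ops A → PathFml Ops A
  | untl : Fml Ops A → Fml Ops A → PathFml Ops A

end

mutual

/-- Satisfaction of a non-quantified formula in a state of a Markov chain. -/
noncomputable def Fml.Sat {Ops : Operators} {A : Type} (D : DTMC A) : Fml Ops A → D.State → Prop
  | .tru, _ => True
  | .atom a, x => a ∈ D.label x
  | .and φ ψ, x => φ.Sat D x ∧ ψ.Sat D x
  | .neg φ, x => ¬ φ.Sat D x
  | .cmp r p q, x => r.eval (p.val D x) (q.val D x)

/-- The value of a probability expression in a state of a Markov chain. -/
noncomputable def ProbExpr.val {Ops : Operators} {A : Type} (D : DTMC A) :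
    ProbExpr Ops A → D.State → ℝ
  | .prob φ, x => (D.pathMeasure x).real {π | φ.Sat D π}
  | .op f _ args, x => f fun i => (args i).val D x

/-- Satisfaction of a path formula along a path of a Markov chain. -/
noncomputable def PathFml.Sat {Ops : Operators} {A : Type} (D : DTMC A) :
    PathFml Ops A → (ℕ → D.State) → Prop
  | .next φ, π => φ.Sat D (π 1)
  | .untl φ ψ, π => ∃ j, ψ.Sat D (π j) ∧ ∀ i < j, φ.Sat D (π i)

end

namespace Fml

variable {Ops : Operators} {A : Type}

def or (φ ψ : Fml Ops A) : Fml Ops A := neg (and (neg φ) (neg ψ))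

def imp (φ ψ : Fml Ops A) : Fml Ops A := neg (and φ (neg ψ))

/-- The finite conjunction of the formulas `φ i`. -/
noncomputable def conj {I : Type} [Fintype I] (φ : I → Fml Ops A) : Fml Ops A :=
  (Finset.univ.toList.map φ).foldr and tru

/-- `P(○ φ) = 0`, where the right-hand side `0` is written as `P(○ ¬true)`. -/
def nextNull (φ : Fml Ops A) : Fml Ops A :=
  cmp .eq (.prob (.next φ)) (.prob (.next (neg tru)))

/-- `P(□ φ) = 1`. As `P(□ φ)` stands for `1 - P(true U ¬φ)`, this is `P(true U ¬φ) = 0`; the right-hand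
side `0` is again written as `P(○ ¬true)`. -/
def almostAlways (φ : Fml Ops A) : Fml Ops A :=
  cmp .eq (.prob (.untl tru (neg φ))) (.prob (.next (neg tru)))

end Fml

/-! ### Quantified formulas

Variables are numbered in the order of their quantifiers, so that a formula in whose context `m`
variables of a kind are quantified refers to them as the elements of `Fin m`; a quantifier binds the
variable `m`. In this way all formulas are well-formed. -/

/-- State-quantified formulas with `m` scheduler variables and `l` state variables in scope; after
the state quantifiers follows a formula from `B l`, where `l` is the total number of state
variables. The quantifier for the state variable `ŝ(σ̂ᵢ)` is `all i` or `ex i`. -/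
inductive StateQ (B : ℕ → Type) (m : ℕ) : ℕ → Type
  | all {l : ℕ} : Fin m → StateQ B m (l + 1) → StateQ B m l
  | ex {l : ℕ} : Fin m → StateQ B m (l + 1) → StateQ B m l
  | body {l : ℕ} : B l → StateQ B m l

/-- Scheduler-quantified formulas with `m` scheduler variables in scope. -/
inductive SchedQ (B : ℕ → Type) : ℕ → Type
  | all {m : ℕ} : SchedQ B (m + 1) → SchedQ B m
  | ex {m : ℕ} : SchedQ B (m + 1) → SchedQ B m
  | body {m : ℕ} : StateQ B m 0 → SchedQ B m

/-- Stutter-quantified formulas with `l` state variables and `n` stutter-scheduler variables in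
scope. The quantifier for the stutter-scheduler variable `τ̂(ŝᵢ)` is `all i` or `ex i`; the atom
`a_τ̂ⱼ` is `(a, j)`. -/
inductive StutterQ (Ops : Operators) (AP : Type) (l : ℕ) : ℕ → Type
  | all {n : ℕ} : Fin l → StutterQ Ops AP l (n + 1) → StutterQ Ops AP l n
  | ex {n : ℕ} : Fin l → StutterQ Ops AP l (n + 1) → StutterQ Ops AP l n
  | body {n : ℕ} : Fml Ops (AP × Fin n) → StutterQ Ops AP l n

/-- HyperPCTL formulas: scheduler quantifiers, then state quantifiers, then a non-quantified
formula with atoms `a_ŝᵢ`, written `(a, i)`. -/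
abbrev HyperPCTL (Ops : Operators) (AP : Type) : Type :=
  SchedQ (fun l => Fml Ops (AP × Fin l)) 0

/-- AHyperPCTL formulas: scheduler quantifiers, then state quantifiers, then stutter quantifiers,
then a non-quantified formula. -/
abbrev AHyperPCTL (Ops : Operators) (AP : Type) : Type :=
  SchedQ (fun l => StutterQ Ops AP l 0) 0

section Semantics

variable {Ops : Operators} {AP S Act : Type} [Fintype S] [Fintype Act] {M : MDP AP S Act}

/-- Semantics of state quantifiers, given the values `σ` of the scheduler variables, the values `s`
of the state variables together with their schedulers, and the meaning `sat` of the formulas below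
the quantifiers. -/
def StateQ.Sat {B : ℕ → Type} {m : ℕ} (sat : ∀ l, B l → (Fin l → Scheduler M × S) → Prop)
    (σ : Fin m → Scheduler M) :
    {l : ℕ} → StateQ B m l → (Fin l → Scheduler M × S) → Prop
  | _, .all i φ, s => ∀ t : S, φ.Sat sat σ (Fin.snoc (α := fun _ => Scheduler M × S) s (σ i, t))
  | _, .ex i φ, s => ∃ t : S, φ.Sat sat σ (Fin.snoc (α := fun _ => Scheduler M × S) s (σ i, t))
  | l, .body φ, s => sat l φ s

/-- Semantics of scheduler quantifiers. -/
def SchedQ.Sat {B : ℕ → Type} (sat : ∀ l, B l → (Fin l → Scheduler M × S) → Prop) :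
    {m : ℕ} → SchedQ B m → (Fin m → Scheduler M) → Prop
  | _, .all φ, σ => ∀ ρ : Scheduler M, φ.Sat sat (Fin.snoc (α := fun _ => Scheduler M) σ ρ)
  | _, .ex φ, σ => ∃ ρ : Scheduler M, φ.Sat sat (Fin.snoc (α := fun _ => Scheduler M) σ ρ)
  | _, .body φ, σ => φ.Sat sat σ Fin.elim0

/-- An experiment: a scheduler, a stutter-scheduler and an initial state. -/
structure Experiment (M : MDP AP S Act) where
  sched : Scheduler M
  stutter : StutterScheduler M
  start : S

/-- Semantics of stutter quantifiers; they range over the fair stutter-schedulers. The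
non-quantified formula is evaluated in the composition of the Markov chains induced by the
experiments. -/
def StutterQ.Sat {l : ℕ} (s : Fin l → Scheduler M × S) :
    {n : ℕ} → StutterQ Ops AP l n → (Fin n → Experiment M) → Prop
  | _, .all i φ, x => ∀ τ : StutterScheduler M, τ.Fair (s i).1 →
      φ.Sat s (Fin.snoc (α := fun _ => Experiment M) x ⟨(s i).1, τ, (s i).2⟩)
  | _, .ex i φ, x => ∃ τ : StutterScheduler M, τ.Fair (s i).1 ∧
      φ.Sat s (Fin.snoc (α := fun _ => Experiment M) x ⟨(s i).1, τ, (s i).2⟩)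
  | _, .body φ, x => φ.Sat (DTMC.compose fun k => M.induced (x k).sched (x k).stutter)
      (fun k => ((x k).sched.init (x k).start, (x k).stutter.init (x k).start, (x k).start))

/-- `M ⊨ φ` for a HyperPCTL formula `φ`. -/
def MDP.SatHyper (M : MDP AP S Act) (φ : HyperPCTL Ops AP) : Prop :=
  SchedQ.Sat (M := M)
    (fun _ ψ s => ψ.Sat (DTMC.compose fun i => M.inducedSync (s i).1)
      (fun i => ((s i).1.init (s i).2, (s i).2)))
    φ Fin.elim0

/-- `M ⊨ φ` for an AHyperPCTL formula `φ`. -/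
def MDP.SatAHyper (M : MDP AP S Act) (φ : AHyperPCTL Ops AP) : Prop :=
  SchedQ.Sat (M := M) (fun _ ψ s => ψ.Sat s Fin.elim0) φ Fin.elim0

end Semantics

/-! ### Adding universal stutter quantifiers to a formula -/

section Translation

/-- The number of state variables of a formula. -/
def StateQ.numState {B : ℕ → Type} {m : ℕ} : {l : ℕ} → StateQ B m l → ℕ
  | _, .all _ φ => φ.numState
  | _, .ex _ φ => φ.numState
  | l, .body _ => l

def SchedQ.numState {B : ℕ → Type} : {m : ℕ} → SchedQ B m → ℕ
  | _, .all φ => φ.numState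
  | _, .ex φ => φ.numState
  | _, .body φ => φ.numState

/-- Keep the quantifiers and replace the formula below them by `χ`. -/
def StateQ.replaceBody {B B' : ℕ → Type} {m : ℕ} :
    {l : ℕ} → (φ : StateQ B m l) → B' φ.numState → StateQ B' m l
  | _, .all i φ, χ => .all i (φ.replaceBody χ)
  | _, .ex i φ, χ => .ex i (φ.replaceBody χ)
  | _, .body _, χ => .body χ

def SchedQ.replaceBody {B B' : ℕ → Type} :
    {m : ℕ} → (φ : SchedQ B m) → B' φ.numState → SchedQ B' m
  | _, .all φ, χ => .all (φ.replaceBody χ)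
  | _, .ex φ, χ => .ex (φ.replaceBody χ)
  | _, .body φ, χ => .body (φ.replaceBody χ)

variable {Ops : Operators} {AP : Type}

/-- `∀ τ̂₀(ŝ₀) … ∀ τ̂ₖ₋₁(ŝₖ₋₁). ψ`. -/
def StutterQ.allUpTo {l : ℕ} :
    (k : ℕ) → k ≤ l → StutterQ Ops AP l k → StutterQ Ops AP l 0
  | 0, _, ψ => ψ
  | k + 1, h, ψ => StutterQ.allUpTo k (Nat.le_of_succ_le h) (.all ⟨k, h⟩ ψ)

/-- The AHyperPCTL formula with the scheduler and state quantifiers of `φ`, followed by one universal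
stutter quantifier `∀ τ̂ᵢ(ŝᵢ)` for each state variable `ŝᵢ`, followed by `χ`. -/
def HyperPCTL.withStutter {AP' : Type} (φ : HyperPCTL Ops AP)
    (χ : Fml Ops (AP' × Fin φ.numState)) : AHyperPCTL Ops AP' :=
  SchedQ.replaceBody (B' := fun l => StutterQ Ops AP' l 0) φ
    (StutterQ.allUpTo φ.numState le_rfl (.body χ))

end Translation

/-! ### Turning self-loops into two-state loops -/

namespace MDP

variable {AP S Act : Type} [Fintype S] [Fintype Act] (M : MDP AP S Act)

/-- `s` has a self-loop. -/
def SelfLoop (s : S) : Prop := ∃ α, M.P s α s ≠ 0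

/-- The states of the transformed decision process: each state `s` of `M` as `(s, false)`, and for
each state `s` with a self-loop a copy `(s, true)`. -/
abbrev UnrolledState : Type := {x : S × Bool // x.2 = true → M.SelfLoop x.1}

open Classical in
noncomputable instance : Fintype M.UnrolledState := Subtype.fintype _

open Classical in
/-- Transition probabilities of the transformed process: a self-loop at `s` becomes the loop
`(s, false) → (s, true) → (s, false)`; all other transitions of `s` are transitions of `(s, false)`
and of `(s, true)` and lead to the original of the target state. -/
noncomputable def unrolledP (x : M.UnrolledState) (α : Act) (y : M.UnrolledState) : ℝ≥0 :=
  if y.1.1 = x.1.1 then (if y.1.2 = !x.1.2 then M.P x.1.1 α x.1.1 else 0)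
  else (if y.1.2 = false then M.P x.1.1 α y.1.1 else 0)

theorem sum_unrolledP (x : M.UnrolledState) (α : Act) :
    ∑ y, M.unrolledP x α y = ∑ s', M.P x.1.1 α s' := by
  classical
  obtain ⟨⟨s, b⟩, hx⟩ := x
  have h0 : ∀ t, ¬ M.SelfLoop t → M.P t α t = 0 := fun t ht => by
    by_contra h; exact ht ⟨α, h⟩
  rw [← Finset.sum_fiberwise Finset.univ (fun y : M.UnrolledState => y.1.1)]
  refine Finset.sum_congr rfl fun t _ => ?_
  by_cases hts : t = s
  · subst hts
    by_cases hc : (!b) = true → M.SelfLoop t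
    · rw [Finset.sum_eq_single (⟨(t, !b), hc⟩ : M.UnrolledState)]
      · simp [unrolledP]
      · rintro ⟨⟨u, c⟩, hu⟩ h1 h2
        simp only [Finset.mem_filter, Finset.mem_univ, true_and] at h1
        subst h1
        have : c ≠ !b := fun h => h2 (by subst h; rfl)
        simp [unrolledP, this]
      · intro h; simp at h
    · push Not at hc
      rw [h0 t hc.2]
      refine Finset.sum_eq_zero ?_
      rintro ⟨⟨u, c⟩, hu⟩ h1
      simp only [Finset.mem_filter, Finset.mem_univ, true_and] at h1
      subst h1
      simp [unrolledP, h0 u hc.2]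
  · rw [Finset.sum_eq_single (⟨(t, false), by simp⟩ : M.UnrolledState)]
    · simp [unrolledP, hts]
    · rintro ⟨⟨u, c⟩, hu⟩ h1 h2
      simp only [Finset.mem_filter, Finset.mem_univ, true_and] at h1
      subst h1
      have : c ≠ false := fun h => h2 (by subst h; rfl)
      simp [unrolledP, hts, this]
    · intro h; simp at h

/-- The transformed decision process `M'`: each self-loop becomes a two-state loop, and each state
`x` gets, in addition to the labels of the state of `M` that it stems from, its own label
`Sum.inr x`. -/
noncomputable def unroll : MDP (AP ⊕ (S × Bool)) M.UnrolledState Act where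
  label x := Sum.inl '' M.label x.1.1 ∪ {Sum.inr x.1}
  P := M.unrolledP
  exists_enabled x := by simpa only [sum_unrolledP] using M.exists_enabled x.1.1
  enabled_or_disabled x α := by simpa only [sum_unrolledP] using M.enabled_or_disabled x.1.1 α

end MDP

/-- The formula which says that all stutter-schedulers are trivial: almost surely always, for each
experiment `i` and each state label `x`, if the current state of `i` has the label `x` then the
probability that the next one has it is `0`. -/
noncomputable def trivialStutter (Ops : Operators) (AP S : Type) [Fintype S] (n : ℕ) :
    Fml Ops ((AP ⊕ (S × Bool)) × Fin n) :=
  .almostAlways (.conj fun p : Fin n × (S × Bool) =>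
    .imp (.atom (Sum.inr p.2, p.1)) (.nextNull (.atom (Sum.inr p.2, p.1))))

end HyperLogic

open HyperLogic

/-!
Everything rests on functional bisimulations between Markov chains (`DTMC.IsHomOn`). The first-step
decomposition `DTMC.pathMeasure_eq_sum` of the path measure implies that such a map carries path
measures to path measures (`DTMC.IsHomOn.map_pathMeasure`), so that it preserves non-quantified
formulas (`DTMC.IsHomOn.sat_iff`); this is also true if it respects transitions only on a set of
states that the chain cannot leave, and it is compatible with the composition of chains.

*At least as expressive.* Since `M'` has no self-loops, `trivial` says that no state that is reached
with positive probability can stutter. The states satisfying `trivial` are closed under transitions,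
and forgetting the modes of the stutter-schedulers is a functional bisimulation from these states to
the chain without stuttering; on the other hand the scheduler that never stutters is fair and
trivial. Hence the quantification over trivial stutter-schedulers evaluates `χ` in the chains of `M'`
without stuttering (`satAHyper_withStutter`). Schedulers of `M` and of `M'` induce bisimilar chains
from the original states: a scheduler of `M` ignores whether a state is a copy
(`MDP.schedRel_liftSched`), and conversely a scheduler of `M` can compute this information from the
previous state of `M'`, which it keeps in its mode (`MDP.schedRel_foldSched`). Thus `χ` is the body
of `φ`, relativized to original states, which are recognized by their labels
(`exists_replaceBody_stateQ`).

*Strictness.* HyperPCTL sees only the chains induced by schedulers, and these are the same for two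
processes that differ by duplicates of actions (`ActionFree.satHyper_iff`); the same holds for the
transformed processes. A stutter-scheduler, however, reads the actions. In a process that alternates
between two states, it can use a random choice between two equivalent actions as a coin toss, and
decide later, depending on the outcome, whether to stutter. With a single action its modes evolve
deterministically, so that no information on the past is available except through its own choices
between stuttering and proceeding; the formula `coinFormula` rules out the latter, by demanding that
all successors of the initial state carry the same label, and thus tells the two processes apart.
-/

namespace HyperLogic

/-! ### Path measures and the first-step decomposition -/

namespace DTMC

variable {AP : Type} (D : DTMC AP)

instance (x : D.State) : IsProbabilityMeasure (D.pathMeasure x) :=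
  inferInstanceAs (IsProbabilityMeasure (Kernel.traj (X := fun _ : ℕ => D.State) D.kernel 0 _))

/-- The paths that agree with `h` up to time `n`. -/
def cylinder {X : Type} (n : ℕ) (h : ℕ → X) : Set (ℕ → X) := {π | ∀ i ≤ n, π i = h i}

theorem cylinder_eq_preimage {X : Type} (n : ℕ) (h : ℕ → X) :
    cylinder n h = Preorder.frestrictLe (π := fun _ => X) n ⁻¹' {Preorder.frestrictLe n h} := by
  ext π
  simp only [cylinder, Set.mem_ofPred_eq, Set.mem_preimage, Set.mem_singleton_iff, funext_iff,
    Preorder.frestrictLe_apply, Subtype.forall, Finset.mem_Iic]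

theorem measurableSet_cylinder (n : ℕ) (h : ℕ → D.State) : MeasurableSet (cylinder n h) := by
  rw [cylinder_eq_preimage]
  exact (Preorder.measurable_frestrictLe n) (MeasurableSet.singleton _)

/-- Probability measures on paths are determined by their values on cylinders. -/
theorem measure_ext_cylinder {μ ν : Measure (ℕ → D.State)} [IsFiniteMeasure μ] [IsFiniteMeasure ν]
    (H : ∀ n h, μ (cylinder n h) = ν (cylinder n h)) : μ = ν := by
  let P : ∀ I : Finset ℕ, Measure ((i : I) → (fun _ : ℕ => D.State) i) := fun I =>
    μ.map I.restrict
  have hμ : IsProjectiveLimit (α := fun _ => D.State) μ P := fun I => rfl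
  have hP : IsProjectiveMeasureFamily (α := fun _ => D.State) P := by
    intro I J hJI
    simp only [P]
    rw [Measure.map_map (by fun_prop) (by fun_prop)]
    rfl
  have : ∀ I, IsFiniteMeasure (P I) := fun I => by dsimp only [P]; infer_instance
  refine hμ.unique ?_
  rw [isProjectiveLimit_nat_iff hP]
  intro n
  refine Measure.ext_of_singleton fun u => ?_
  obtain ⟨h, rfl⟩ : ∃ h : ℕ → D.State, u = Preorder.frestrictLe n h := by
    refine ⟨fun i => u ⟨min i n, by simp⟩, ?_⟩
    ext ⟨i, hi⟩
    simp [Finset.mem_Iic.1 hi]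
  have h1 : ∀ ρ : Measure (ℕ → D.State),
      ρ.map (Preorder.frestrictLe (π := fun _ => D.State) n) {Preorder.frestrictLe n h}
        = ρ (cylinder n h) := fun ρ => by
    rw [Measure.map_apply (Preorder.measurable_frestrictLe n) (MeasurableSet.singleton _),
      cylinder_eq_preimage]
  exact (h1 ν).trans ((H n h).symm.trans (h1 μ).symm)

open Classical in
theorem pathMeasure_cylinder_zero (x : D.State) (h : ℕ → D.State) :
    D.pathMeasure x (cylinder 0 h) = if h 0 = x then 1 else 0 := by
  have h1 := Kernel.traj_map_frestrictLe_apply (X := fun _ : ℕ => D.State) (κ := D.kernel) 0 0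
    (fun _ => x)
  rw [cylinder_eq_preimage, ← Measure.map_apply (Preorder.measurable_frestrictLe 0)
    (MeasurableSet.singleton _)]
  change (Measure.map _ (Kernel.traj (X := fun _ : ℕ => D.State) D.kernel 0 (fun _ => x))) _ = _
  rw [h1, Kernel.partialTraj_self, Kernel.id_apply, Measure.dirac_apply' _ (MeasurableSet.singleton _)]
  simp only [Set.indicator_apply, Set.mem_singleton_iff, Pi.one_apply]
  refine if_congr ⟨fun e => ?_, fun e => ?_⟩ rfl rfl
  · exact (congrFun e ⟨0, by simp⟩).symm
  · ext ⟨i, hi⟩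
    obtain rfl : i = 0 := by simpa using hi
    exact e.symm

theorem pathMeasure_cylinder_succ (x : D.State) (n : ℕ) (h : ℕ → D.State) :
    D.pathMeasure x (cylinder (n + 1) h)
      = D.pathMeasure x (cylinder n h) * D.step (h n) (h (n + 1)) := by
  have h1 := Kernel.partialTraj_compProd_eq_map_traj (X := fun _ : ℕ => D.State) (κ := D.kernel)
    (Nat.zero_le n) (x₀ := fun _ => x)
  have h2 : cylinder (n + 1) h
      = (fun π : ℕ → D.State => (Preorder.frestrictLe (π := fun _ => D.State) n π, π (n + 1))) ⁻¹'
        ({Preorder.frestrictLe n h} ×ˢ {h (n + 1)}) := by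
    ext π
    have := Set.ext_iff.1 (cylinder_eq_preimage n h) π
    simp only [Set.mem_preimage, Set.mem_singleton_iff] at this
    simp only [Set.mem_preimage, Set.mem_prod, Set.mem_singleton_iff, ← this, cylinder,
      Set.mem_ofPred_eq]
    constructor
    · exact fun H => ⟨fun i hi => H i (by omega), H _ le_rfl⟩
    · rintro ⟨H, H'⟩ i hi
      rcases Nat.lt_or_ge n i with hn | hn
      · obtain rfl : i = n + 1 := by omega
        exact H'
      · exact H i hn
  have h3 : MeasurableSet
      (({Preorder.frestrictLe n h} : Set ((i : Finset.Iic n) → D.State)) ×ˢ {h (n + 1)}) :=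
    (MeasurableSet.singleton _).prod (MeasurableSet.singleton _)
  have h4 : Measurable
      (fun π : ℕ → D.State => (Preorder.frestrictLe (π := fun _ => D.State) n π, π (n + 1))) := by
    fun_prop
  rw [h2, ← Measure.map_apply h4 h3]
  change (Measure.map _ (Kernel.traj (X := fun _ : ℕ => D.State) D.kernel 0 (fun _ => x))) _ = _
  rw [← h1, Measure.compProd_apply_prod (MeasurableSet.singleton _) (MeasurableSet.singleton _),
    lintegral_singleton, ← Kernel.traj_map_frestrictLe_apply,
    Measure.map_apply (Preorder.measurable_frestrictLe n) (MeasurableSet.singleton _),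
    ← cylinder_eq_preimage, mul_comm]
  congr 1
  exact PMF.toMeasure_apply_singleton _ _ (MeasurableSet.singleton _)

open Classical in
theorem pathMeasure_cylinder (x : D.State) (n : ℕ) (h : ℕ → D.State) :
    D.pathMeasure x (cylinder n h)
      = (if h 0 = x then 1 else 0) * ∏ i ∈ Finset.range n, D.step (h i) (h (i + 1)) := by
  induction n with
  | zero => rw [pathMeasure_cylinder_zero, Finset.prod_range_zero, mul_one]
  | succ n ih => rw [pathMeasure_cylinder_succ, ih, Finset.prod_range_succ, mul_assoc]

/-- The path that starts in `x` and continues with `π`. -/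
def prepend {X : Type} (x : X) (π : ℕ → X) : ℕ → X
  | 0 => x
  | n + 1 => π n

theorem measurable_prepend (x : D.State) : Measurable (prepend x) := by
  refine measurable_pi_lambda _ fun n => ?_
  cases n with
  | zero => exact measurable_const
  | succ n => exact measurable_pi_apply n

/-- First-step decomposition: a random path from `x` is `x` followed by a random path from a
random successor of `x`. -/
theorem pathMeasure_eq_sum (x : D.State) :
    D.pathMeasure x
      = Measure.sum fun y => D.step x y • (D.pathMeasure y).map (prepend x) := by
  classical
  have hm := D.measurable_prepend x
  have hp : ∀ y, IsProbabilityMeasure ((D.pathMeasure y).map (prepend x)) := fun y =>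
    Measure.isProbabilityMeasure_map hm.aemeasurable
  have hfin : IsFiniteMeasure
      (Measure.sum fun y => D.step x y • (D.pathMeasure y).map (prepend x)) := by
    refine ⟨?_⟩
    rw [Measure.sum_apply _ MeasurableSet.univ]
    simp [(D.step x).tsum_coe]
  refine D.measure_ext_cylinder fun n h => ?_
  rw [Measure.sum_apply _ (D.measurableSet_cylinder n h)]
  simp only [Measure.smul_apply, smul_eq_mul, Measure.map_apply hm (D.measurableSet_cylinder n h)]
  cases n with
  | zero =>
    rw [pathMeasure_cylinder_zero]
    by_cases h0 : h 0 = x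
    · have : prepend x ⁻¹' cylinder 0 h = Set.univ := by
        ext π; simp [cylinder, prepend, h0]
      simp [this, h0, (D.step x).tsum_coe]
    · have : prepend x ⁻¹' cylinder 0 h = ∅ := by
        ext π; simp [cylinder, prepend, Ne.symm h0]
      simp [this, h0]
  | succ n =>
    by_cases h0 : h 0 = x
    · have : prepend x ⁻¹' cylinder (n + 1) h = cylinder n fun i => h (i + 1) := by
        ext π
        simp only [cylinder, Set.mem_preimage, Set.mem_ofPred_eq]
        constructor
        · exact fun H i hi => H (i + 1) (by omega)
        · rintro H (_ | i) hi
          · exact h0.symm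
          · exact H i (by omega)
      simp only [this]
      rw [tsum_eq_single (h 1) (fun y hy => by rw [pathMeasure_cylinder]; simp [Ne.symm hy]),
        pathMeasure_cylinder, pathMeasure_cylinder, Finset.prod_range_succ']
      simp [h0, mul_comm]
    · have : prepend x ⁻¹' cylinder (n + 1) h = ∅ := by
        ext π
        simp only [cylinder, Set.mem_preimage, Set.mem_ofPred_eq, Set.mem_empty_iff_false, iff_false]
        exact fun H => h0 (H 0 (by omega)).symm
      rw [pathMeasure_cylinder]
      simp [this, h0]

theorem pathMeasure_apply (x : D.State) {A : Set (ℕ → D.State)} (hA : MeasurableSet A) :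
    D.pathMeasure x A = ∑' y, D.step x y * D.pathMeasure y (prepend x ⁻¹' A) := by
  conv_lhs => rw [pathMeasure_eq_sum, Measure.sum_apply _ hA]
  simp only [Measure.smul_apply, smul_eq_mul, Measure.map_apply (D.measurable_prepend x) hA]

theorem ae_pathMeasure_iff (x : D.State) {p : (ℕ → D.State) → Prop}
    (hp : MeasurableSet {π | p π}) :
    (∀ᵐ π ∂D.pathMeasure x, p π) ↔
      ∀ y, D.step x y ≠ 0 → ∀ᵐ π ∂D.pathMeasure y, p (prepend x π) := by
  rw [ae_iff, show {π | ¬ p π} = {π | p π}ᶜ from rfl, pathMeasure_apply _ _ hp.compl, ENNReal.tsum_eq_zero]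
  simp only [mul_eq_zero, or_iff_not_imp_left]
  rfl

theorem ae_zero (x : D.State) : ∀ᵐ π ∂D.pathMeasure x, π 0 = x :=
  (D.ae_pathMeasure_iff x ((measurable_pi_apply 0) (MeasurableSet.singleton x))).2
    fun _ _ => Filter.Eventually.of_forall fun _ => rfl

theorem measurableSet_eval (n : ℕ) (s : Set D.State) :
    MeasurableSet {π : ℕ → D.State | π n ∈ s} :=
  (measurable_pi_apply n) (MeasurableSet.of_discrete (s := s))

/-- Almost surely, a path stays in a set that is closed under transitions of positive
probability. -/
theorem ae_mem_of_closed {I : Set D.State} (hI : ∀ x ∈ I, ∀ y, D.step x y ≠ 0 → y ∈ I)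
    {x : D.State} (hx : x ∈ I) : ∀ᵐ π ∂D.pathMeasure x, ∀ n, π n ∈ I := by
  rw [ae_all_iff]
  intro n
  induction n generalizing x with
  | zero => filter_upwards [D.ae_zero x] with π h; rwa [h]
  | succ n ih =>
    exact (D.ae_pathMeasure_iff x (D.measurableSet_eval (n + 1) I)).2 fun y hy => ih (hI x hx y hy)

/-- Almost surely, a path uses only transitions of positive probability. -/
theorem ae_step_ne_zero (x : D.State) :
    ∀ᵐ π ∂D.pathMeasure x, ∀ n, D.step (π n) (π (n + 1)) ≠ 0 := by
  rw [ae_all_iff]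
  intro n
  have hm : ∀ m, MeasurableSet {π : ℕ → D.State | D.step (π m) (π (m + 1)) ≠ 0} := fun m =>
    ((measurable_pi_apply m).prodMk (measurable_pi_apply (m + 1)) :
      Measurable fun π : ℕ → D.State => (π m, π (m + 1)))
      (MeasurableSet.of_discrete (s := {p : D.State × D.State | D.step p.1 p.2 ≠ 0}))
  induction n generalizing x with
  | zero =>
    refine (D.ae_pathMeasure_iff x (hm _)).2 fun y hy => ?_
    filter_upwards [D.ae_zero y] with π h
    simpa [prepend, h] using hy
  | succ n ih =>
    refine (D.ae_pathMeasure_iff x (hm _)).2 fun y _ => ih y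

end DTMC

/-! ### Functional bisimulations preserve non-quantified formulas -/

theorem tsum_map_mul {X Y : Type} (p : PMF X) (f : X → Y) (g : Y → ℝ≥0∞) :
    ∑' y, p.map f y * g y = ∑' x, p x * g (f x) := by
  classical
  simp only [PMF.map_apply, ← ENNReal.tsum_mul_right]
  rw [ENNReal.tsum_comm]
  refine tsum_congr fun x => ?_
  rw [tsum_eq_single (f x) (fun y hy => by simp [hy])]
  simp

theorem PathFml.measurableSet_sat {Ops : Operators} {A : Type} (D : DTMC A) (φ : PathFml Ops A) :
    MeasurableSet {π | φ.Sat D π} := by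
  cases φ with
  | next φ => exact D.measurableSet_eval 1 {x | φ.Sat D x}
  | untl φ ψ =>
    have : {π | (PathFml.untl φ ψ).Sat D π}
        = ⋃ j, {π | ψ.Sat D (π j)} ∩ ⋂ i, ⋂ _ : i < j, {π | φ.Sat D (π i)} := by
      ext π; simp [PathFml.Sat]
    rw [this]
    exact .iUnion fun j => (D.measurableSet_eval j {x | ψ.Sat D x}).inter
      (.iInter fun i => .iInter fun _ => D.measurableSet_eval i {x | φ.Sat D x})

namespace DTMC

/-- `f` maps `D` to `E` and, on the set `I` of states, which is closed under transitions of
positive probability, respects labels and transition probabilities. -/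
structure IsHomOn {A : Type} (D E : DTMC A) (f : D.State → E.State) (I : Set D.State) : Prop where
  closed : ∀ x ∈ I, ∀ y, D.step x y ≠ 0 → y ∈ I
  map_step : ∀ x ∈ I, (D.step x).map f = E.step (f x)
  label : ∀ x ∈ I, D.label x = E.label (f x)

variable {A : Type} {D E : DTMC A}

theorem measurable_comp_left (f : D.State → E.State) :
    Measurable fun π : ℕ → D.State => f ∘ π :=
  measurable_pi_lambda _ fun n => (Measurable.of_discrete (f := f)).comp (measurable_pi_apply n)

/-- Induction on the length of cylinders, with the first-step decomposition on both sides. -/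
theorem IsHomOn.map_pathMeasure {f : D.State → E.State} {I : Set D.State} (h : IsHomOn D E f I)
    {x : D.State} (hx : x ∈ I) : (D.pathMeasure x).map (f ∘ ·) = E.pathMeasure (f x) := by
  have hf := measurable_comp_left (D := D) (E := E) f
  have := Measure.isProbabilityMeasure_map (μ := D.pathMeasure x) hf.aemeasurable
  refine E.measure_ext_cylinder fun n u => ?_
  rw [Measure.map_apply hf (E.measurableSet_cylinder n u)]
  induction n generalizing x u with
  | zero =>
    rw [pathMeasure_cylinder_zero]
    split_ifs with h0
    · refine (mem_ae_iff_prob_eq_one (hf (E.measurableSet_cylinder 0 u))).1 ?_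
      filter_upwards [D.ae_zero x] with π hπ
      intro i hi
      obtain rfl : i = 0 := by omega
      exact (congrArg f hπ).trans h0.symm
    · refine measure_eq_zero_iff_ae_notMem.2 ?_
      filter_upwards [D.ae_zero x] with π hπ
      exact fun H => h0 ((H 0 le_rfl).symm.trans (congrArg f hπ))
  | succ n ih =>
    rw [pathMeasure_apply _ _ (hf (E.measurableSet_cylinder _ u)),
      pathMeasure_apply _ _ (E.measurableSet_cylinder _ u), ← h.map_step x hx, tsum_map_mul]
    refine tsum_congr fun y => ?_
    by_cases hy : D.step x y = 0
    · rw [hy, zero_mul, zero_mul]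
    have key : ∀ {F : DTMC A} (v : F.State) (g : F.State → E.State),
        prepend v ⁻¹' ((g ∘ ·) ⁻¹' cylinder (n + 1) u)
          = {π | g v = u 0} ∩ (g ∘ ·) ⁻¹' cylinder n fun i => u (i + 1) := by
      intro F v g
      ext π
      simp only [cylinder, Set.mem_preimage, Set.mem_ofPred_eq, Set.mem_inter_iff]
      constructor
      · exact fun H => ⟨H 0 (by omega), fun i hi => H (i + 1) (by omega)⟩
      · rintro ⟨H0, H⟩ (_ | i) hi
        · exact H0
        · exact H i (by omega)
    have k1 := key (F := D) x f
    have k2 := key (F := E) (f x) id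
    simp only [Function.id_comp, Set.preimage_id', id] at k2
    rw [k1, k2]
    congr 1
    by_cases h0 : f x = u 0
    · simp only [h0, Set.ofPred_true, Set.univ_inter]
      exact ih (h.closed x hx y hy) (Measure.isProbabilityMeasure_map hf.aemeasurable) _
    · simp [h0]

mutual

theorem IsHomOn.sat_iff {Ops : Operators} {f : D.State → E.State} {I : Set D.State}
    (h : IsHomOn D E f I) : ∀ (φ : Fml Ops A) {x : D.State}, x ∈ I → (φ.Sat D x ↔ φ.Sat E (f x))
  | .tru, _, _ => by simp only [Fml.Sat]
  | .atom a, x, hx => by simp only [Fml.Sat]; rw [h.label x hx]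
  | .and φ ψ, x, hx => by simp only [Fml.Sat]; rw [h.sat_iff φ hx, h.sat_iff ψ hx]
  | .neg φ, x, hx => by simp only [Fml.Sat]; rw [h.sat_iff φ hx]
  | .cmp r p q, x, hx => by simp only [Fml.Sat]; rw [h.val_eq p hx, h.val_eq q hx]

theorem IsHomOn.val_eq {Ops : Operators} {f : D.State → E.State} {I : Set D.State}
    (h : IsHomOn D E f I) : ∀ (p : ProbExpr Ops A) {x : D.State}, x ∈ I →
      p.val D x = p.val E (f x)
  | .prob φ, x, hx => by
    simp only [ProbExpr.val, Measure.real]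
    rw [← h.map_pathMeasure hx, Measure.map_apply (measurable_comp_left f)
      (PathFml.measurableSet_sat E φ)]
    congr 1
    refine measure_congr (Filter.eventuallyEq_set.2 ?_)
    filter_upwards [D.ae_mem_of_closed h.closed hx] with π hπ
    exact h.path_sat_iff φ hπ
  | .op g _ args, x, hx => by
    simp only [ProbExpr.val]
    congr 1
    funext i
    exact h.val_eq (args i) hx

theorem IsHomOn.path_sat_iff {Ops : Operators} {f : D.State → E.State} {I : Set D.State}
    (h : IsHomOn D E f I) : ∀ (φ : PathFml Ops A) {π : ℕ → D.State}, (∀ n, π n ∈ I) →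
      (φ.Sat D π ↔ φ.Sat E (f ∘ π))
  | .next φ, π, hπ => by simp only [PathFml.Sat]; exact h.sat_iff φ (hπ 1)
  | .untl φ ψ, π, hπ => by
    simp only [PathFml.Sat]
    exact exists_congr fun j => and_congr (h.sat_iff ψ (hπ j))
      (forall₂_congr fun i _ => h.sat_iff φ (hπ i))

end

theorem compose_step_apply {n : ℕ} (D : Fin n → DTMC A) (x y : (compose D).State) :
    (compose D).step x y = ∏ i, (D i).step (x i) (y i) := rfl

theorem compose_step_toMeasure {n : ℕ} (D : Fin n → DTMC A) (x : ∀ i, (D i).State)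
    (p : PMF (∀ i, (D i).State)) (hp : p = (compose D).step x) :
    p.toMeasure = Measure.pi fun i => ((D i).step (x i)).toMeasure := by
  refine Measure.ext_of_singleton fun y => ?_
  rw [Measure.pi_singleton, PMF.toMeasure_apply_singleton _ _ (MeasurableSet.singleton y), hp]
  exact (compose_step_apply D x y).trans <| Finset.prod_congr rfl fun i _ =>
    (PMF.toMeasure_apply_singleton ((D i).step (x i)) (y i) (MeasurableSet.singleton _)).symm

theorem compose_step_ne_zero {n : ℕ} {D : Fin n → DTMC A} {x y : (compose D).State} :
    (compose D).step x y ≠ 0 ↔ ∀ i, (D i).step (x i) (y i) ≠ 0 := by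
  rw [compose_step_apply, Finset.prod_ne_zero_iff]; simp

theorem map_compose_step {n : ℕ} {B : Type} (D : Fin n → DTMC A) (E : Fin n → DTMC B)
    (f : ∀ i, (D i).State → (E i).State) (x : ∀ i, (D i).State)
    (h : ∀ i, ((D i).step (x i)).map (f i) = (E i).step (f i (x i))) :
    ((compose D).step x).map (fun y i => f i (y i)) = (compose E).step fun i => f i (x i) := by
  have hf : ∀ i, Measurable (f i) := fun i => Measurable.of_discrete
  have hF : Measurable fun (y : ∀ i, (D i).State) i => f i (y i) :=
    measurable_pi_lambda _ fun i => (hf i).comp (measurable_pi_apply i)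
  have : ∀ i, IsProbabilityMeasure (((D i).step (x i)).toMeasure.map (f i)) := fun i =>
    Measure.isProbabilityMeasure_map (hf i).aemeasurable
  have key : ∀ (p : PMF (∀ i, (D i).State)) (q : PMF (∀ i, (E i).State)),
      p = (compose D).step x → (q = (compose E).step fun i => f i (x i)) →
      p.map (fun y i => f i (y i)) = q := by
    intro p q hp hq
    refine PMF.toMeasure_injective ?_
    rw [← PMF.toMeasure_map _ p hF, compose_step_toMeasure D x p hp,
      compose_step_toMeasure E _ q hq, Measure.pi_map_pi fun i => (hf i).aemeasurable]
    simp only [PMF.toMeasure_map _ _ (hf _), h]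
  exact key _ _ rfl rfl

/-- `(D, x)` and `(E, y)` are bisimilar: both are images of one pointed chain under functional
bisimulations. Spans are used because, in a composition of chains, the maps between the components
may go in different directions. -/
def Bisim (D E : DTMC A) (x : D.State) (y : E.State) : Prop :=
  ∃ (C : DTMC A) (f : C.State → D.State) (g : C.State → E.State) (z : C.State),
    IsHomOn C D f Set.univ ∧ IsHomOn C E g Set.univ ∧ f z = x ∧ g z = y

theorem IsHomOn.id (D : DTMC A) : IsHomOn D D (fun x => x) Set.univ :=
  ⟨fun _ _ _ _ => trivial, fun _ _ => PMF.map_id _, fun _ _ => rfl⟩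

theorem IsHomOn.bisim {f : D.State → E.State} (h : IsHomOn D E f Set.univ) (x : D.State) :
    Bisim D E x (f x) :=
  ⟨D, _, f, x, .id D, h, rfl, rfl⟩

theorem Bisim.symm {x : D.State} {y : E.State} : Bisim D E x y → Bisim E D y x
  | ⟨C, f, g, z, hf, hg, hx, hy⟩ => ⟨C, g, f, z, hg, hf, hy, hx⟩

theorem Bisim.sat_iff {Ops : Operators} {x : D.State} {y : E.State} (h : Bisim D E x y)
    (φ : Fml Ops A) : φ.Sat D x ↔ φ.Sat E y := by
  obtain ⟨C, f, g, z, hf, hg, rfl, rfl⟩ := h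
  exact (hf.sat_iff φ trivial).symm.trans (hg.sat_iff φ trivial)

theorem IsHomOn.compose {n : ℕ} {D E : Fin n → DTMC A} {f : ∀ i, (D i).State → (E i).State}
    (h : ∀ i, IsHomOn (D i) (E i) (f i) Set.univ) :
    IsHomOn (compose D) (compose E) (fun x i => f i (x i)) Set.univ where
  closed _ _ _ _ := trivial
  map_step x _ := map_compose_step D E f x fun i => (h i).map_step (x i) trivial
  label x _ := by
    ext p
    exact Set.ext_iff.1 ((h p.2).label (x p.2) trivial) p.1

theorem Bisim.compose {n : ℕ} {D E : Fin n → DTMC A} {x : ∀ i, (D i).State}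
    {y : ∀ i, (E i).State} (h : ∀ i, Bisim (D i) (E i) (x i) (y i)) :
    Bisim (compose D) (compose E) x y := by
  choose C f g z hf hg hx hy using h
  exact ⟨DTMC.compose C, _, _, z, .compose hf, .compose hg, funext hx, funext hy⟩

/-- The chain `D` with labels in `B`, where `b` is a label of `x` if `g b` is. -/
def relabel {B : Type} (D : DTMC A) (g : B → A) : DTMC B where
  State := D.State
  countable := D.countable
  label x := g ⁻¹' D.label x
  step := D.step

end DTMC

/-! ### Renaming atoms -/

section Map

variable {Ops : Operators} {A B : Type} (g : B → A)

mutual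

/-- Rename the atoms of a formula. -/
def Fml.map : Fml Ops B → Fml Ops A
  | .tru => .tru
  | .atom b => .atom (g b)
  | .and φ ψ => .and φ.map ψ.map
  | .neg φ => .neg φ.map
  | .cmp r p q => .cmp r p.map q.map

/-- Rename the atoms of a probability expression. -/
def ProbExpr.map : ProbExpr Ops B → ProbExpr Ops A
  | .prob φ => .prob φ.map
  | .op f hf args => .op f hf fun i => (args i).map

/-- Rename the atoms of a path formula. -/
def PathFml.map : PathFml Ops B → PathFml Ops A
  | .next φ => .next φ.map
  | .untl φ ψ => .untl φ.map ψ.map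

end

mutual

theorem Fml.sat_map (D : DTMC A) :
    ∀ (φ : Fml Ops B) (x : D.State), (φ.map g).Sat D x ↔ φ.Sat (D.relabel g) x
  | .tru, _ => by simp only [Fml.map, Fml.Sat]
  | .atom b, x => by simp only [Fml.map, Fml.Sat]; rfl
  | .and φ ψ, x => by simp only [Fml.map, Fml.Sat]; rw [φ.sat_map, ψ.sat_map]
  | .neg φ, x => by simp only [Fml.map, Fml.Sat]; rw [φ.sat_map]
  | .cmp r p q, x => by simp only [Fml.map, Fml.Sat]; rw [p.val_map, q.val_map]

theorem ProbExpr.val_map (D : DTMC A) :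
    ∀ (p : ProbExpr Ops B) (x : D.State), (p.map g).val D x = p.val (D.relabel g) x
  | .prob φ, x => by
    simp only [ProbExpr.map, ProbExpr.val]
    simp only [φ.sat_map D]
    rfl
  | .op f _ args, x => by
    simp only [ProbExpr.map, ProbExpr.val]
    congr 1
    funext i
    exact (args i).val_map D x

theorem PathFml.sat_map (D : DTMC A) :
    ∀ (φ : PathFml Ops B) (π : ℕ → D.State), (φ.map g).Sat D π ↔ φ.Sat (D.relabel g) π
  | .next φ, π => by simp only [PathFml.map, PathFml.Sat]; exact φ.sat_map D (π 1)
  | .untl φ ψ, π => by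
    simp only [PathFml.map, PathFml.Sat]
    exact exists_congr fun j => and_congr (ψ.sat_map D (π j))
      (forall₂_congr fun i _ => φ.sat_map D (π i))

end

end Map

/-! ### Boolean connectives and comparisons of probabilities with zero -/

section Support

variable {Ops : Operators} {A : Type} (D : DTMC A)

theorem Fml.sat_imp (φ ψ : Fml Ops A) (x : D.State) :
    (φ.imp ψ).Sat D x ↔ (φ.Sat D x → ψ.Sat D x) := by
  simp only [Fml.imp, Fml.Sat]; tauto

theorem Fml.sat_foldr_and (l : List (Fml Ops A)) (x : D.State) :
    (l.foldr Fml.and .tru).Sat D x ↔ ∀ φ ∈ l, φ.Sat D x := by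
  induction l with
  | nil => simp [Fml.Sat]
  | cons φ l ih => simp [Fml.Sat, ih]

theorem Fml.sat_conj {I : Type} [Fintype I] (φ : I → Fml Ops A) (x : D.State) :
    (Fml.conj φ).Sat D x ↔ ∀ i, (φ i).Sat D x := by
  simp [Fml.conj, Fml.sat_foldr_and]

theorem Fml.sat_prob_eq_zero (φ : PathFml Ops A) (x : D.State) :
    (Fml.cmp .eq (.prob φ) (.prob (.next (.neg .tru)))).Sat D x
      ↔ ∀ᵐ π ∂D.pathMeasure x, ¬ φ.Sat D π := by
  simp only [Fml.Sat, Cmp.eval, ProbExpr.val, PathFml.Sat, not_true_eq_false]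
  simp [Measure.real, ENNReal.toReal_eq_zero_iff, ae_iff]

theorem Fml.sat_nextNull (φ : Fml Ops A) (x : D.State) :
    φ.nextNull.Sat D x ↔ ∀ y, D.step x y ≠ 0 → ¬ φ.Sat D y := by
  rw [Fml.nextNull, Fml.sat_prob_eq_zero,
    D.ae_pathMeasure_iff x (p := fun π => ¬ (PathFml.next φ).Sat D π)
      (PathFml.measurableSet_sat D (.next φ)).compl]
  refine forall₂_congr fun y _ => ?_
  simp only [PathFml.Sat, DTMC.prepend]
  refine ⟨fun h => ?_, fun h => ?_⟩
  · obtain ⟨π, h1, h2⟩ := (h.and (D.ae_zero y)).exists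
    rwa [h2] at h1
  · filter_upwards [D.ae_zero y] with π hπ
    rwa [hπ]

theorem Fml.sat_almostAlways (φ : Fml Ops A) (x : D.State) :
    φ.almostAlways.Sat D x ↔ ∀ᵐ π ∂D.pathMeasure x, ∀ j, φ.Sat D (π j) := by
  rw [Fml.almostAlways, Fml.sat_prob_eq_zero]
  simp [PathFml.Sat, Fml.Sat]

theorem Fml.sat_of_almostAlways {φ : Fml Ops A} {x : D.State} (h : φ.almostAlways.Sat D x) :
    φ.Sat D x := by
  rw [Fml.sat_almostAlways] at h
  obtain ⟨π, h1, h2⟩ := (h.and (D.ae_zero x)).exists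
  exact h2 ▸ h1 0

/-- The states that satisfy `ℙ(□ φ) = 1` are closed under transitions of positive probability. -/
theorem Fml.almostAlways_step {φ : Fml Ops A} {x y : D.State} (h : φ.almostAlways.Sat D x)
    (hxy : D.step x y ≠ 0) : φ.almostAlways.Sat D y := by
  rw [Fml.sat_almostAlways] at h ⊢
  have hm : MeasurableSet {π : ℕ → D.State | ∀ j, φ.Sat D (π j)} := by
    rw [Set.ofPred_forall]
    exact .iInter fun j => D.measurableSet_eval j {x | φ.Sat D x}
  filter_upwards [(D.ae_pathMeasure_iff x hm).1 h y hxy] with π hπ j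
  exact hπ (j + 1)

end Support

/-! ### Stuttering and the formula `trivial` -/

namespace MDP

variable {AP S Act : Type} [Fintype S] [Fintype Act] {M : MDP AP S Act}

theorem jointWeight_stutter_ne_zero {σ : Scheduler M} {τ : StutterScheduler M}
    {x y : Config σ τ} : jointWeight σ τ x (.stutter, y) ≠ 0 ↔
      y.1 = x.1 ∧ y.2.2 = x.2.2 ∧ ∃ α, τ.mode x.2.1 x.2.2 α = y.2.1 ∧
        σ.act x.1 x.2.2 α ≠ 0 ∧ τ.act x.2.1 x.2.2 α .stutter ≠ 0 := by
  classical
  simp only [jointWeight, stut, ne_eq, ite_eq_right_iff, Finset.sum_eq_zero_iff,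
    Finset.mem_filter, Finset.mem_univ, true_and, mul_eq_zero]
  grind

theorem jointWeight_proceed_ne_zero {σ : Scheduler M} {τ : StutterScheduler M}
    {x y : Config σ τ} : jointWeight σ τ x (.proceed, y) ≠ 0 ↔
      y.1 = σ.mode x.1 x.2.2 ∧ ∃ α, τ.mode x.2.1 x.2.2 α = y.2.1 ∧
        σ.act x.1 x.2.2 α ≠ 0 ∧ τ.act x.2.1 x.2.2 α .proceed ≠ 0 ∧ M.P x.2.2 α y.2.2 ≠ 0 := by
  classical
  simp only [jointWeight, cont, ne_eq, ite_eq_right_iff, Finset.sum_eq_zero_iff,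
    Finset.mem_filter, Finset.mem_univ, true_and, mul_eq_zero]
  grind

theorem induced_step_ne_zero {σ : Scheduler M} {τ : StutterScheduler M} {x y : Config σ τ} :
    (M.induced σ τ).step x y ≠ 0 ↔
      jointWeight σ τ x (.stutter, y) ≠ 0 ∨ jointWeight σ τ x (.proceed, y) ≠ 0 := by
  have h : ∀ p, p ∈ (jointStep σ τ x).support ↔ jointWeight σ τ x p ≠ 0 := fun p => by
    rw [PMF.mem_support_iff]
    exact ENNReal.coe_ne_zero
  have key : y ∈ (PMF.map Prod.snd (jointStep σ τ x)).support ↔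
      jointWeight σ τ x (.stutter, y) ≠ 0 ∨ jointWeight σ τ x (.proceed, y) ≠ 0 := by
    simp only [PMF.mem_support_map_iff, h]
    constructor
    · rintro ⟨⟨_ | _, y⟩, hy, rfl⟩
      exacts [.inl hy, .inr hy]
    · rintro (hy | hy)
      exacts [⟨_, hy, rfl⟩, ⟨_, hy, rfl⟩]
  exact key

theorem recorded_step_ne_zero {σ : Scheduler M} {τ : StutterScheduler M}
    {x y : Choice × Config σ τ} :
    (M.recorded σ τ).step x y ≠ 0 ↔ jointWeight σ τ x.2 y ≠ 0 :=
  ENNReal.coe_ne_zero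

/-- Where no stuttering is possible, a step of `M^{σ,τ}` is a step of `M^σ`. -/
theorem map_induced_step {σ : Scheduler M} {τ : StutterScheduler M} (x : Config σ τ)
    (h : ∀ α, σ.act x.1 x.2.2 α ≠ 0 → τ.act x.2.1 x.2.2 α .stutter = 0) :
    ((M.induced σ τ).step x).map (fun y => (y.1, y.2.2))
      = (M.inducedSync σ).step (x.1, x.2.2) := by
  classical
  have h0 : ∀ y, jointWeight σ τ x (.stutter, y) = 0 := fun y => by
    by_contra hy
    obtain ⟨-, -, α, -, h1, h2⟩ := jointWeight_stutter_ne_zero.1 hy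
    exact h2 (h α h1)
  have h1 : ∀ s', ∑ α, σ.act x.1 x.2.2 α * τ.act x.2.1 x.2.2 α .proceed * M.P x.2.2 α s'
      = ∑ α, σ.act x.1 x.2.2 α * M.P x.2.2 α s' := fun s' => by
    refine Finset.sum_congr rfl fun α _ => ?_
    by_cases hα : σ.act x.1 x.2.2 α = 0
    · simp [hα]
    · have := τ.sum_act x.2.1 x.2.2 α
      rw [h α hα, zero_add] at this
      rw [this, mul_one]
  have h3 : (Finset.univ : Finset Choice) = {.stutter, .proceed} := rfl
  ext ⟨q', s'⟩
  change (PMF.map (fun y => (y.1, y.2.2)) (PMF.map Prod.snd (jointStep σ τ x))) (q', s') =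
    if q' = σ.mode x.1 x.2.2 then
      ((∑ α, σ.act x.1 x.2.2 α * M.P x.2.2 α s' : ℝ≥0) : ℝ≥0∞) else 0
  rw [PMF.map_comp, PMF.map_apply, ENNReal.tsum_prod', tsum_fintype, h3,
    Finset.sum_pair (by decide)]
  have h4 : ∀ c y, jointStep σ τ x (c, y) = (jointWeight σ τ x (c, y) : ℝ≥0∞) := fun _ _ => rfl
  simp only [h4, h0, Function.comp_apply, ENNReal.coe_zero, ite_self, tsum_zero, zero_add,
    Prod.mk.injEq]
  rw [ENNReal.tsum_prod', tsum_eq_single q' (fun q hq => by simp [Ne.symm hq]),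
    ENNReal.tsum_prod']
  split_ifs with hq
  · rw [← h1, ← tsum_fiber (τ.mode x.2.1 x.2.2)]
    refine tsum_congr fun e => ?_
    rw [tsum_eq_single s' (fun s hs => by simp [Ne.symm hs])]
    simp [jointWeight, hq, cont]
  · simp [jointWeight, hq]

/-- The stutter-scheduler that never stutters. -/
def neverStutter (M : MDP AP S Act) : StutterScheduler M where
  Q := Unit
  countable := inferInstance
  nonempty := inferInstance
  mode _ _ _ := ()
  init _ := ()
  act _ _ _ c := if c = .proceed then 1 else 0
  sum_act _ _ _ := by simp

theorem neverStutter_fair (σ : Scheduler M) : (neverStutter M).Fair σ := by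
  intro s
  refine measure_eq_zero_iff_ae_notMem.2 ?_
  filter_upwards [(M.recorded σ (neverStutter M)).ae_step_ne_zero _] with π hπ
  rintro ⟨N, hN⟩
  have h1 := recorded_step_ne_zero.1 (hπ N)
  have h2 : π (N + 1) = (.stutter, (π (N + 1)).2) := Prod.ext (hN (N + 1) (by omega)) rfl
  rw [h2] at h1
  obtain ⟨-, -, α, -, -, h2⟩ := jointWeight_stutter_ne_zero.1 h1
  exact h2 (by simp [neverStutter])

variable (M)

/-- The transformed process has no self-loops. -/
theorem unroll_P_self (x : M.UnrolledState) (α : Act) : M.unroll.P x α x = 0 := by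
  simp [unroll, unrolledP]

theorem mem_unroll_label_inr {x : M.UnrolledState} {y : S × Bool} :
    (Sum.inr y : AP ⊕ (S × Bool)) ∈ M.unroll.label x ↔ y = x.1 := by
  simp [unroll]

theorem mem_unroll_label_inl {x : M.UnrolledState} {a : AP} :
    (Sum.inl a : AP ⊕ (S × Bool)) ∈ M.unroll.label x ↔ a ∈ M.label x.1.1 := by
  simp [unroll]

variable {M}

/-- The conjunction under the `□` of `trivial` says that no experiment can stutter in its current
state: as the transformed process has no self-loops, its state is kept exactly by stuttering. -/
theorem sat_noStutter_iff {Ops : Operators} {n : ℕ} (σ : Fin n → Scheduler M.unroll)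
    (τ : Fin n → StutterScheduler M.unroll) (x : ∀ i, Config (σ i) (τ i)) :
    (Fml.conj fun p : Fin n × (S × Bool) =>
      Fml.imp (.atom (Sum.inr p.2, p.1)) (.nextNull (.atom (Sum.inr p.2, p.1))) :
        Fml Ops ((AP ⊕ (S × Bool)) × Fin n)).Sat
      (DTMC.compose fun i => M.unroll.induced (σ i) (τ i)) x ↔
    ∀ i α, (σ i).act (x i).1 (x i).2.2 α ≠ 0 →
      (τ i).act (x i).2.1 (x i).2.2 α .stutter = 0 := by
  classical
  have hl : ∀ (y : ∀ i, Config (σ i) (τ i)) (z : S × Bool) (i : Fin n),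
      (Fml.atom (Sum.inr z, i) : Fml Ops ((AP ⊕ (S × Bool)) × Fin n)).Sat
        (DTMC.compose fun i => M.unroll.induced (σ i) (τ i)) y ↔ z = (y i).2.2.1 := fun y z i => by
    exact M.mem_unroll_label_inr
  have hp : ∀ p : Fin n × (S × Bool),
      (Fml.imp (.atom (Sum.inr p.2, p.1)) (.nextNull (.atom (Sum.inr p.2, p.1))) :
        Fml Ops ((AP ⊕ (S × Bool)) × Fin n)).Sat
      (DTMC.compose fun i => M.unroll.induced (σ i) (τ i)) x ↔
      (p.2 = (x p.1).2.2.1 → ∀ y : ∀ i, Config (σ i) (τ i),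
        (∀ i, (M.unroll.induced (σ i) (τ i)).step (x i) (y i) ≠ 0) →
        ¬ p.2 = (y p.1).2.2.1) := fun p =>
    (Fml.sat_imp _ _ _ _).trans <| imp_congr (hl x p.2 p.1) <|
      (Fml.sat_nextNull _ _ _).trans <| forall_congr' fun y =>
        imp_congr DTMC.compose_step_ne_zero <| not_congr (hl y p.2 p.1)
  refine (Fml.sat_conj _ _ _).trans <| (forall_congr' hp).trans ?_
  constructor
  · intro h i α h1
    by_contra h2
    obtain ⟨y, hy⟩ := PMF.support_nonempty
      ((DTMC.compose fun i => M.unroll.induced (σ i) (τ i)).step x)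
    replace hy := DTMC.compose_step_ne_zero.1 hy
    -- Let experiment `i` stutter while the others take a possible step.
    let z : ∀ i, Config (σ i) (τ i) := Function.update y i
      ((x i).1, (τ i).mode (x i).2.1 (x i).2.2 α, (x i).2.2)
    have hzi : z i = ((x i).1, (τ i).mode (x i).2.1 (x i).2.2 α, (x i).2.2) :=
      Function.update_self ..
    refine h (i, (x i).2.2.1) rfl z (fun j => ?_) (by rw [hzi])
    by_cases hj : j = i
    · subst hj
      rw [hzi]
      exact induced_step_ne_zero.2 (.inl (jointWeight_stutter_ne_zero.2
        ⟨rfl, rfl, α, rfl, h1, h2⟩))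
    · have : z j = y j := Function.update_of_ne hj ..
      rw [this]
      exact hy j
  · rintro h ⟨i, z⟩ hx y hy hz
    have hz := hx.symm.trans hz
    rcases induced_step_ne_zero.1 (hy i) with h1 | h1
    · obtain ⟨-, -, α, -, h2, h3⟩ := jointWeight_stutter_ne_zero.1 h1
      exact h3 (h i α h2)
    · obtain ⟨-, α, -, -, -, h2⟩ := jointWeight_proceed_ne_zero.1 h1
      rw [← Subtype.ext hz] at h2
      exact h2 (M.unroll_P_self _ α)

/-- Under trivial stutter-schedulers, formulas cannot distinguish between the chains with and
without stuttering. -/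
theorem forall_trivial_imp_iff {Ops : Operators} {n : ℕ}
    (s : Fin n → Scheduler M.unroll × M.UnrolledState)
    (χ : Fml Ops ((AP ⊕ (S × Bool)) × Fin n)) :
    (∀ τ : Fin n → StutterScheduler M.unroll, (∀ i, (τ i).Fair (s i).1) →
      (Fml.imp (trivialStutter Ops AP S n) χ).Sat
        (DTMC.compose fun i => M.unroll.induced (s i).1 (τ i))
        (fun i => ((s i).1.init (s i).2, (τ i).init (s i).2, (s i).2))) ↔
    χ.Sat (DTMC.compose fun i => M.unroll.inducedSync (s i).1)
      (fun i => ((s i).1.init (s i).2, (s i).2)) := by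
  have key : ∀ τ : Fin n → StutterScheduler M.unroll, DTMC.IsHomOn
      (DTMC.compose fun i => M.unroll.induced (s i).1 (τ i))
      (DTMC.compose fun i => M.unroll.inducedSync (s i).1)
      (fun x i => ((x i).1, (x i).2.2))
      {x | (trivialStutter Ops AP S n).Sat
        (DTMC.compose fun i => M.unroll.induced (s i).1 (τ i)) x} := fun τ =>
    { closed := fun x hx y hxy => Fml.almostAlways_step _ hx hxy
      map_step := fun x hx => DTMC.map_compose_step (fun i => M.unroll.induced (s i).1 (τ i))
        (fun i => M.unroll.inducedSync (s i).1)
        (fun i (y : Config (s i).1 (τ i)) => (y.1, y.2.2)) x fun i =>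
        map_induced_step (x i) ((sat_noStutter_iff _ _ x).1 (Fml.sat_of_almostAlways _ hx) i)
      label := fun x _ => rfl }
  constructor
  · intro h
    have h1 := h (fun _ => neverStutter M.unroll) fun i => neverStutter_fair _
    replace h1 := (Fml.sat_imp _ _ _ _).1 h1
    have ht : (trivialStutter Ops AP S n).Sat
        (DTMC.compose fun i => M.unroll.induced (s i).1 (neverStutter M.unroll))
        (fun i => ((s i).1.init (s i).2, (neverStutter M.unroll).init (s i).2, (s i).2)) :=
      (Fml.sat_almostAlways _ _ _).2 <| Filter.Eventually.of_forall fun π j =>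
        (sat_noStutter_iff (fun i => (s i).1) (fun _ => neverStutter M.unroll) (π j)).2
          fun i α _ => by simp [neverStutter]
    exact ((key _).sat_iff χ ht).1 (h1 ht)
  · intro h τ _
    exact (Fml.sat_imp _ _ _ _).2 fun ht => ((key τ).sat_iff χ ht).2 h

end MDP

/-! ### Replacing the formula below the quantifiers -/

section Quantifiers

variable {Ops : Operators} {AP S Act : Type} [Fintype S] [Fintype Act] {M : MDP AP S Act}

theorem StutterQ.sat_allUpTo {AP' : Type} {M : MDP AP' S Act} {l : ℕ}
    (s : Fin l → Scheduler M × S) (k : ℕ) (hk : k ≤ l) (ψ : StutterQ Ops AP' l k) :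
    (StutterQ.allUpTo k hk ψ).Sat s Fin.elim0 ↔
      ∀ τ : Fin k → StutterScheduler M, (∀ i, (τ i).Fair (s (Fin.castLE hk i)).1) →
        ψ.Sat s fun i => ⟨(s (Fin.castLE hk i)).1, τ i, (s (Fin.castLE hk i)).2⟩ := by
  induction k with
  | zero =>
    have : ∀ τ : Fin 0 → StutterScheduler M, (fun i : Fin 0 =>
        (⟨(s (Fin.castLE hk i)).1, τ i, (s (Fin.castLE hk i)).2⟩ : Experiment M)) = Fin.elim0 :=
      fun τ => funext fun i => i.elim0
    simp only [this, StutterQ.allUpTo]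
    exact ⟨fun h _ _ => h, fun h => h Fin.elim0 fun i => i.elim0⟩
  | succ k ih =>
    rw [StutterQ.allUpTo, ih]
    simp only [StutterQ.Sat]
    constructor
    · intro h τ hτ
      convert! h (fun i => τ i.castSucc) (fun i => hτ i.castSucc) (τ (Fin.last k))
        (hτ (Fin.last k)) using 1
      funext i
      refine Fin.lastCases ?_ (fun i => ?_) i
      · rw [Fin.snoc_last]; rfl
      · rw [Fin.snoc_castSucc]; rfl
    · intro h τ hτ ρ hρ
      convert! h (Fin.snoc (α := fun _ => StutterScheduler M) τ ρ) (fun i => ?_) using 1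
      · funext i
        refine Fin.lastCases ?_ (fun i => ?_) i
        · rw [Fin.snoc_last, Fin.snoc_last]; rfl
        · rw [Fin.snoc_castSucc, Fin.snoc_castSucc]; rfl
      · refine Fin.lastCases ?_ (fun i => ?_) i
        · rw [Fin.snoc_last]; exact hρ
        · rw [Fin.snoc_castSucc]; exact hτ i

theorem StateQ.le_numState {B : ℕ → Type} {m : ℕ} : {l : ℕ} → (φ : StateQ B m l) → l ≤ φ.numState
  | _, .all _ φ => (Nat.le_succ _).trans φ.le_numState
  | _, .ex _ φ => (Nat.le_succ _).trans φ.le_numState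
  | _, .body _ => le_rfl

variable {B B₁ B₂ : ℕ → Type} {sat₁ : ∀ l, B₁ l → (Fin l → Scheduler M × S) → Prop}
  {sat₂ : ∀ l, B₂ l → (Fin l → Scheduler M × S) → Prop}

/-- `u` assigns the values `s` to the first state variables. -/
def Extends {X : Type*} {l n : ℕ} (h : l ≤ n) (s : Fin l → X) (u : Fin n → X) : Prop :=
  ∀ j, u (Fin.castLE h j) = s j

theorem Extends.of_snoc {X : Type*} {l n : ℕ} {h : l + 1 ≤ n} {s : Fin l → X} {a : X}
    {u : Fin n → X} (hu : Extends h (Fin.snoc (α := fun _ => X) s a) u) :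
    Extends ((Nat.le_succ l).trans h) s u ∧ u ⟨l, h⟩ = a := by
  refine ⟨fun j => ?_, ?_⟩
  · have := hu j.castSucc
    rw [Fin.snoc_castSucc] at this
    exact this
  · have := hu (Fin.last l)
    rw [Fin.snoc_last] at this
    exact this

/-- Only the assignments that extend the current one matter for the formula below the
quantifiers. -/
theorem StateQ.replaceBody_congr {m l : ℕ} (σ : Fin m → Scheduler M) (φ : StateQ B m l)
    (χ₁ : B₁ φ.numState) (χ₂ : B₂ φ.numState) (s : Fin l → Scheduler M × S)
    (h : ∀ u, Extends φ.le_numState s u → (sat₁ _ χ₁ u ↔ sat₂ _ χ₂ u)) :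
    (φ.replaceBody χ₁).Sat sat₁ σ s ↔ (φ.replaceBody χ₂).Sat sat₂ σ s := by
  induction φ with
  | all i φ ih => exact forall_congr' fun t => ih _ _ _ fun u hu => h u hu.of_snoc.1
  | ex i φ ih => exact exists_congr fun t => ih _ _ _ fun u hu => h u hu.of_snoc.1
  | body ψ => exact h s fun j => rfl

/-- A formula below the quantifiers whose truth value is already determined makes the quantifiers
redundant. -/
theorem StateQ.replaceBody_const [Nonempty S] {m l : ℕ} (σ : Fin m → Scheduler M)
    (φ : StateQ B m l) (χ : B₁ φ.numState) (s : Fin l → Scheduler M × S) (p : Prop)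
    (h : ∀ u, Extends φ.le_numState s u → (sat₁ _ χ u ↔ p)) :
    (φ.replaceBody χ).Sat sat₁ σ s ↔ p := by
  induction φ with
  | all i φ ih =>
    exact (forall_congr' fun t => ih _ _ fun u hu => h u hu.of_snoc.1).trans (forall_const S)
  | ex i φ ih =>
    exact (exists_congr fun t => ih _ _ fun u hu => h u hu.of_snoc.1).trans (exists_const S)
  | body ψ => exact h s fun j => rfl

theorem SchedQ.replaceBody_congr {m : ℕ} (σ : Fin m → Scheduler M) (φ : SchedQ B m)
    (χ₁ : B₁ φ.numState) (χ₂ : B₂ φ.numState) (h : ∀ u, sat₁ _ χ₁ u ↔ sat₂ _ χ₂ u) :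
    (φ.replaceBody χ₁).Sat sat₁ σ ↔ (φ.replaceBody χ₂).Sat sat₂ σ := by
  induction φ with
  | all φ ih => exact forall_congr' fun ρ => ih _ _ _ h
  | ex φ ih => exact exists_congr fun ρ => ih _ _ _ h
  | body φ => exact φ.replaceBody_congr σ χ₁ χ₂ _ fun u _ => h u

/-- Satisfaction of a non-quantified formula in the chains without stuttering that are given by
the values `s` of the state variables. -/
def satSync (M : MDP AP S Act) (l : ℕ) (ψ : Fml Ops (AP × Fin l))
    (s : Fin l → Scheduler M × S) : Prop :=
  ψ.Sat (DTMC.compose fun i => M.inducedSync (s i).1) fun i => ((s i).1.init (s i).2, (s i).2)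

/-- Quantifying over the trivial stutter-schedulers amounts to evaluating a formula without
stuttering. -/
theorem satAHyper_withStutter (φ : HyperPCTL Ops AP)
    (χ : Fml Ops ((AP ⊕ (S × Bool)) × Fin φ.numState)) :
    M.unroll.SatAHyper (HyperPCTL.withStutter φ
      (Fml.imp (trivialStutter Ops AP S φ.numState) χ)) ↔
    SchedQ.Sat (satSync M.unroll)
      (SchedQ.replaceBody (B' := fun l => Fml Ops ((AP ⊕ (S × Bool)) × Fin l)) φ χ)
      Fin.elim0 := by
  refine SchedQ.replaceBody_congr (B₂ := fun l => Fml Ops ((AP ⊕ (S × Bool)) × Fin l))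
    (sat₂ := satSync M.unroll) _ φ _ χ fun u => ?_
  rw [StutterQ.sat_allUpTo]
  exact MDP.forall_trivial_imp_iff u χ

end Quantifiers

/-! ### Schedulers of the original and of the transformed process -/

namespace MDP

variable {AP S Act : Type} [Fintype S] [Fintype Act] (M : MDP AP S Act)

open Classical in
theorem map_inducedSync_step_apply {Y : Type} (σ : Scheduler M) (x : σ.Q × S) (f : σ.Q × S → Y)
    (y : Y) : ((M.inducedSync σ).step x).map f y =
      ((∑ t, if y = f (σ.mode x.1 x.2, t) then ∑ α, σ.act x.1 x.2 α * M.P x.2 α t else 0 : ℝ≥0) :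
        ℝ≥0∞) := by
  have h : ∀ a : σ.Q × S, (M.inducedSync σ).step x a = if a.1 = σ.mode x.1 x.2 then
      ((∑ α, σ.act x.1 x.2 α * M.P x.2 α a.2 : ℝ≥0) : ℝ≥0∞) else 0 := fun a => by
    change ite _ _ _ = _
    congr
  have key : ∀ p : PMF (σ.Q × S), (∀ a, p a = if a.1 = σ.mode x.1 x.2 then
      ((∑ α, σ.act x.1 x.2 α * M.P x.2 α a.2 : ℝ≥0) : ℝ≥0∞) else 0) → p.map f y =
      ((∑ t, if y = f (σ.mode x.1 x.2, t) then ∑ α, σ.act x.1 x.2 α * M.P x.2 α t else 0 : ℝ≥0) :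
        ℝ≥0∞) := fun p hp => by
    rw [PMF.map_apply]
    simp only [hp]
    rw [ENNReal.tsum_prod', tsum_eq_single (σ.mode x.1 x.2) (fun q hq => by simp [hq]),
      tsum_fintype, ENNReal.ofNNReal_finsetSum]
    refine Finset.sum_congr rfl fun t _ => ?_
    simp only [if_true]
    split_ifs <;> simp
  exact key _ h

/-- The state `s` of `M`, as a state of the transformed process. -/
def orig (s : S) : M.UnrolledState := ⟨(s, false), by simp⟩

theorem mem_unroll_enabled {x : M.UnrolledState} {α : Act} :
    α ∈ M.unroll.enabled x ↔ α ∈ M.enabled x.1.1 := by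
  change ∑ y, M.unrolledP x α y = 1 ↔ _
  rw [sum_unrolledP]
  rfl

/-- Two schedulers are related if they induce bisimilar chains in `M` and in the transformed
process, for each initial state of `M`. -/
def SchedRel (σ : Scheduler M) (σ' : Scheduler M.unroll) : Prop :=
  ∀ s, DTMC.Bisim (M.inducedSync σ) ((M.unroll.inducedSync σ').relabel Sum.inl)
    (σ.init s, s) (σ'.init (M.orig s), M.orig s)

variable {M}

/-- The scheduler of the transformed process that does not distinguish the copies of a state. -/
def liftSched (σ : Scheduler M) : Scheduler M.unroll where
  Q := σ.Q
  countable := σ.countable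
  nonempty := σ.nonempty
  mode q x := σ.mode q x.1.1
  init x := σ.init x.1.1
  act q x := σ.act q x.1.1
  sum_act q x := σ.sum_act q x.1.1
  act_disabled q x α h := σ.act_disabled q x.1.1 α fun h' => h (M.mem_unroll_enabled.2 h')

open Classical in
theorem sum_unrolledP_fiber (x : M.UnrolledState) (α : Act) (t : S) :
    ∑ y : M.UnrolledState, (if t = y.1.1 then M.unrolledP x α y else 0) = M.P x.1.1 α t := by
  by_cases h : t = x.1.1
  · subst h
    by_cases hc : (!x.1.2) = true → M.SelfLoop x.1.1
    · rw [Finset.sum_eq_single (⟨(x.1.1, !x.1.2), hc⟩ : M.UnrolledState)]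
      · simp [unrolledP]
      · rintro ⟨⟨u, c⟩, hu⟩ - h2
        by_cases h3 : x.1.1 = u
        · subst h3
          have : c ≠ !x.1.2 := fun h => h2 (by subst h; rfl)
          simp [unrolledP, this]
        · simp [h3]
      · simp
    · push Not at hc
      have h0 : M.P x.1.1 α x.1.1 = 0 := by
        by_contra h; exact hc.2 ⟨α, h⟩
      rw [h0]
      refine Finset.sum_eq_zero fun y _ => ?_
      by_cases h3 : x.1.1 = y.1.1
      · simp [unrolledP, h3.symm, h0]
      · simp [h3]
  · rw [Finset.sum_eq_single (M.orig t)]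
    · simp [unrolledP, orig, h]
    · rintro ⟨⟨u, c⟩, hu⟩ - h2
      by_cases h3 : t = u
      · subst h3
        have : c ≠ false := fun h => h2 (by subst h; rfl)
        simp [unrolledP, this, h]
      · simp [h3]
    · simp

theorem schedRel_liftSched (σ : Scheduler M) : M.SchedRel σ (liftSched σ) := by
  classical
  have hom : DTMC.IsHomOn ((M.unroll.inducedSync (liftSched σ)).relabel Sum.inl)
      (M.inducedSync σ) (fun x => (x.1, x.2.1.1)) Set.univ :=
    { closed := fun _ _ _ _ => trivial
      label := fun x _ => Set.ext fun a => M.mem_unroll_label_inl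
      map_step := by
        rintro ⟨p, x⟩ -
        ext ⟨q, t⟩
        refine (M.unroll.map_inducedSync_step_apply (liftSched σ) (p, x) (fun x => (x.1, x.2.1.1))
          (q, t)).trans ?_
        change _ = (ite (q = σ.mode p x.1.1)
          ((∑ α, σ.act p x.1.1 α * M.P x.1.1 α t : ℝ≥0) : ℝ≥0∞) 0)
        by_cases hq : q = σ.mode p x.1.1
        · rw [if_pos hq]
          congr 1
          refine (Finset.sum_congr rfl fun y _ => (?_ : _ = ∑ α, σ.act p x.1.1 α *
            (if t = y.1.1 then M.unrolledP x α y else 0))).trans ?_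
          · by_cases ht : t = y.1.1
            · refine (if_pos (Prod.ext hq ht)).trans ?_
              simp only [if_pos ht]
              rfl
            · refine (if_neg fun h => ht (congrArg Prod.snd h)).trans ?_
              simp only [if_neg ht, mul_zero, Finset.sum_const_zero]
          rw [Finset.sum_comm]
          simp only [← Finset.mul_sum, sum_unrolledP_fiber]
        · rw [if_neg hq]
          simp only [ENNReal.coe_eq_zero]
          exact Finset.sum_eq_zero fun y _ => if_neg fun h => hq (congrArg Prod.fst h) }
  exact fun s => (hom.bisim (((liftSched σ).init (M.orig s), M.orig s) :
    (liftSched σ).Q × M.UnrolledState)).symm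

open Classical in
/-- The current state of the transformed process, if `s` is the current state of `M` and `p` is the
previous state of the transformed process. -/
noncomputable def current (p : Option M.UnrolledState) (s : S) : M.UnrolledState :=
  match p with
  | none => M.orig s
  | some x => if h : s = x.1.1 ∧ x.1.2 = false ∧ M.SelfLoop s then ⟨(s, true), fun _ => h.2.2⟩
    else M.orig s

theorem current_fst (p : Option M.UnrolledState) (s : S) : (current p s).1.1 = s := by
  cases p with
  | none => rfl
  | some x =>
    simp only [current]
    split_ifs <;> rfl

open Classical in
/-- From `x`, the only state over `t` that can be reached is `current (some x) t`. -/
theorem unrolledP_eq_current (x y : M.UnrolledState) (α : Act) :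
    M.unrolledP x α y = if y = current (some x) y.1.1 then M.P x.1.1 α y.1.1 else 0 := by
  obtain ⟨⟨s, b⟩, hb⟩ := x
  obtain ⟨⟨t, c⟩, hc⟩ := y
  simp only [unrolledP, current]
  have h0 : ¬ M.SelfLoop s → M.P s α s = 0 := fun h => by
    by_contra h'; exact h ⟨α, h'⟩
  by_cases hts : t = s
  · subst hts
    by_cases hl : M.SelfLoop t
    · cases b <;> cases c <;> simp [hl, orig]
    · simp [h0 hl]
  · cases c <;> simp [hts, orig]

/-- The scheduler of `M` that simulates a scheduler of the transformed process. Its modes record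
the previous state of the transformed process, which determines whether the current state of `M`
stands for an original or for a copy. -/
noncomputable def foldSched (σ : Scheduler M.unroll) : Scheduler M where
  Q := σ.Q × Option M.UnrolledState
  countable := inferInstance
  nonempty := σ.nonempty.map fun q => (q, none)
  mode q s := (σ.mode q.1 (current q.2 s), some (current q.2 s))
  init s := (σ.init (M.orig s), none)
  act q s := σ.act q.1 (current q.2 s)
  sum_act q s := σ.sum_act q.1 _
  act_disabled q s α h := σ.act_disabled q.1 _ α fun h' => h (by
    simpa only [current_fst] using M.mem_unroll_enabled.1 h')

theorem schedRel_foldSched (σ : Scheduler M.unroll) : M.SchedRel (foldSched σ) σ := by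
  classical
  have hom : DTMC.IsHomOn (M.inducedSync (foldSched σ))
      ((M.unroll.inducedSync σ).relabel Sum.inl)
      (fun x => (x.1.1, current x.1.2 x.2)) Set.univ :=
    { closed := fun _ _ _ _ => trivial
      label := fun x _ => Set.ext fun a => by
        refine Iff.trans ?_ M.mem_unroll_label_inl.symm
        rw [current_fst]
        rfl
      map_step := fun x _ => by
        ext ⟨q, y⟩
        refine (M.map_inducedSync_step_apply (foldSched σ) x _ (q, y)).trans ?_
        change _ = (ite (q = σ.mode x.1.1 (current x.1.2 x.2))
          ((∑ α, σ.act x.1.1 (current x.1.2 x.2) α *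
            M.unrolledP (current x.1.2 x.2) α y : ℝ≥0) : ℝ≥0∞) 0)
        simp only [Prod.mk.injEq]
        by_cases hq : q = σ.mode x.1.1 (current x.1.2 x.2)
        · rw [if_pos hq]
          congr 1
          rw [Finset.sum_eq_single y.1.1]
          · simp only [unrolledP_eq_current _ y, current_fst]
            by_cases hy : y = current (some (current x.1.2 x.2)) y.1.1
            · rw [if_pos ⟨hq, hy⟩]; simp only [if_pos hy]; rfl
            · rw [if_neg fun h => hy h.2]
              simp only [if_neg hy, mul_zero, Finset.sum_const_zero]
          · exact fun t _ ht => if_neg fun h => ht (by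
              have := congrArg (fun z : M.UnrolledState => z.1.1) h.2
              exact ((current_fst _ _).symm.trans this.symm))
          · simp
        · rw [if_neg hq]
          simp only [ENNReal.coe_eq_zero]
          exact Finset.sum_eq_zero fun y _ => if_neg fun h => hq h.1 }
  exact fun s => hom.bisim (((foldSched σ).init s, s) : (foldSched σ).Q × S)

end MDP

/-! ### Relativizing the state quantifiers to original states -/

section Relativize

variable {Ops : Operators} {AP S : Type} [Fintype S]

/-- The formula saying that the `i`-th state is not a copy: it has a label `Sum.inr (s, false)`. -/
noncomputable def isOrig (Ops : Operators) (AP S : Type) [Fintype S] {l : ℕ} (i : Fin l) :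
    Fml Ops ((AP ⊕ (S × Bool)) × Fin l) :=
  .neg (.conj fun s : S => .neg (.atom (Sum.inr (s, false), i)))

theorem satSync_isOrig {Act : Type} [Fintype Act] {M : MDP AP S Act} {l : ℕ} (i : Fin l)
    (u : Fin l → Scheduler M.unroll × M.UnrolledState) :
    satSync M.unroll l (isOrig Ops AP S i) u ↔ (u i).2.1.2 = false := by
  have h : ∀ s : S, (Fml.neg (.atom (Sum.inr (s, false), i)) :
      Fml Ops ((AP ⊕ (S × Bool)) × Fin l)).Sat
      (DTMC.compose fun i => M.unroll.inducedSync (u i).1)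
      (fun i => ((u i).1.init (u i).2, (u i).2)) ↔ ¬ (s, false) = (u i).2.1 := fun s => by
    simp only [Fml.Sat]
    exact not_congr M.mem_unroll_label_inr
  refine (not_congr ((Fml.sat_conj _ _ _).trans (forall_congr' h))).trans ?_
  constructor
  · intro h
    push Not at h
    obtain ⟨s, hs⟩ := h
    rw [← hs]
  · exact fun h h' => h' (u i).2.1.1 (Prod.ext rfl h.symm)

/-- The values of the state variables are related. -/
def StateRel {Act : Type} [Fintype Act] {M : MDP AP S Act} {l : ℕ} (s : Fin l → Scheduler M × S)
    (s' : Fin l → Scheduler M.unroll × M.UnrolledState) : Prop :=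
  ∀ j, M.SchedRel (s j).1 (s' j).1 ∧ (s' j).2 = M.orig (s j).2

theorem StateRel.snoc {Act : Type} [Fintype Act] {M : MDP AP S Act} {l : ℕ}
    {s : Fin l → Scheduler M × S} {s' : Fin l → Scheduler M.unroll × M.UnrolledState}
    (h : StateRel s s') {σ : Scheduler M} {σ' : Scheduler M.unroll} (hσ : M.SchedRel σ σ') (t : S) :
    StateRel (Fin.snoc (α := fun _ => Scheduler M × S) s (σ, t))
      (Fin.snoc (α := fun _ => Scheduler M.unroll × M.UnrolledState) s' (σ', M.orig t)) := by
  refine Fin.lastCases ?_ fun j => ?_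
  · rw [Fin.snoc_last, Fin.snoc_last]; exact ⟨hσ, rfl⟩
  · rw [Fin.snoc_castSucc, Fin.snoc_castSucc]; exact h j

/-- The new body is that of `φ`, renamed and relativized: universally quantified states are assumed
and existentially quantified states are required to be originals. Although the relativization stands
below all the quantifiers, it takes effect at the quantifier in question, since the domain of the
other quantifiers is non-empty. -/
theorem exists_replaceBody_stateQ [Nonempty S] {m l : ℕ} (φ : StateQ (fun l => Fml Ops (AP × Fin l)) m l) :
    ∃ χ : Fml Ops ((AP ⊕ (S × Bool)) × Fin φ.numState),
      ∀ (Act : Type) [Fintype Act] (M : MDP AP S Act) (σ : Fin m → Scheduler M)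
        (σ' : Fin m → Scheduler M.unroll), (∀ i, M.SchedRel (σ i) (σ' i)) →
        ∀ s s', StateRel s s' →
        (φ.Sat (satSync M) σ s ↔
          (φ.replaceBody (B' := fun l => Fml Ops ((AP ⊕ (S × Bool)) × Fin l)) χ).Sat
            (satSync M.unroll) σ' s') := by
  induction φ with
  | @all l i φ ih =>
    obtain ⟨χ, hχ⟩ := ih
    let k : Fin φ.numState := ⟨l, φ.le_numState⟩
    refine ⟨.imp (isOrig Ops AP S k) χ, fun Act _ M σ σ' hσ s s' hs => ?_⟩
    have hne : Nonempty M.UnrolledState := ‹Nonempty S›.map M.orig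
    have key : ∀ t' : M.UnrolledState,
        (φ.replaceBody (B' := fun l => Fml Ops ((AP ⊕ (S × Bool)) × Fin l))
          (.imp (isOrig Ops AP S k) χ)).Sat (satSync M.unroll) σ'
            (Fin.snoc (α := fun _ => Scheduler M.unroll × M.UnrolledState) s' (σ' i, t')) ↔
        (t'.1.2 = false →
          (φ.replaceBody (B' := fun l => Fml Ops ((AP ⊕ (S × Bool)) × Fin l)) χ).Sat
            (satSync M.unroll) σ'
            (Fin.snoc (α := fun _ => Scheduler M.unroll × M.UnrolledState) s' (σ' i, t'))) := by
      intro t'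
      by_cases ht : t'.1.2 = false
      · refine Iff.trans ?_ (forall_prop_of_true ht).symm
        refine φ.replaceBody_congr (B₁ := fun l => Fml Ops ((AP ⊕ (S × Bool)) × Fin l))
          (B₂ := fun l => Fml Ops ((AP ⊕ (S × Bool)) × Fin l)) σ' _ _ _ fun u hu => ?_
        refine (Fml.sat_imp _ _ _ _).trans (forall_prop_of_true ?_)
        refine (satSync_isOrig k u).2 ?_
        rw [hu.of_snoc.2]
        exact ht
      · refine Iff.trans ?_ (iff_of_true trivial fun h => absurd h ht)
        refine φ.replaceBody_const (B₁ := fun l => Fml Ops ((AP ⊕ (S × Bool)) × Fin l))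
          σ' _ _ _ fun u hu => iff_true_intro ?_
        refine (Fml.sat_imp _ _ _ _).2 fun h => absurd ((satSync_isOrig k u).1 h) ?_
        rw [hu.of_snoc.2]
        exact ht
    refine Iff.trans ?_ (forall_congr' key).symm
    constructor
    · rintro h ⟨⟨t, b⟩, hb⟩ (rfl : b = false)
      exact (hχ Act M σ σ' hσ _ _ (hs.snoc (hσ i) t)).1 (h t)
    · exact fun h t => (hχ Act M σ σ' hσ _ _ (hs.snoc (hσ i) t)).2 (h (M.orig t) rfl)
  | @ex l i φ ih =>
    obtain ⟨χ, hχ⟩ := ih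
    let k : Fin φ.numState := ⟨l, φ.le_numState⟩
    refine ⟨.and (isOrig Ops AP S k) χ, fun Act _ M σ σ' hσ s s' hs => ?_⟩
    have hne : Nonempty M.UnrolledState := ‹Nonempty S›.map M.orig
    have key : ∀ t' : M.UnrolledState,
        (φ.replaceBody (B' := fun l => Fml Ops ((AP ⊕ (S × Bool)) × Fin l))
          (.and (isOrig Ops AP S k) χ)).Sat (satSync M.unroll) σ'
            (Fin.snoc (α := fun _ => Scheduler M.unroll × M.UnrolledState) s' (σ' i, t')) ↔
        (t'.1.2 = false ∧
          (φ.replaceBody (B' := fun l => Fml Ops ((AP ⊕ (S × Bool)) × Fin l)) χ).Sat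
            (satSync M.unroll) σ'
            (Fin.snoc (α := fun _ => Scheduler M.unroll × M.UnrolledState) s' (σ' i, t'))) := by
      have hand : ∀ u, satSync M.unroll _ (.and (isOrig Ops AP S k) χ) u ↔
          (satSync M.unroll _ (isOrig Ops AP S k) u ∧ satSync M.unroll _ χ u) := fun u => by
        simp only [satSync, Fml.Sat]
      intro t'
      by_cases ht : t'.1.2 = false
      · refine Iff.trans ?_ (and_iff_right ht).symm
        refine φ.replaceBody_congr (B₁ := fun l => Fml Ops ((AP ⊕ (S × Bool)) × Fin l))
          (B₂ := fun l => Fml Ops ((AP ⊕ (S × Bool)) × Fin l)) σ' _ _ _ fun u hu => ?_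
        refine (hand u).trans (and_iff_right ?_)
        refine (satSync_isOrig k u).2 ?_
        rw [hu.of_snoc.2]
        exact ht
      · refine Iff.trans ?_ (iff_of_false not_false fun h => ht h.1)
        refine φ.replaceBody_const (B₁ := fun l => Fml Ops ((AP ⊕ (S × Bool)) × Fin l))
          σ' _ _ _ fun u hu => iff_false_intro fun h => ?_
        have := (satSync_isOrig k u).1 ((hand u).1 h).1
        rw [hu.of_snoc.2] at this
        exact ht this
    refine Iff.trans ?_ (exists_congr key).symm
    constructor
    · rintro ⟨t, h⟩
      exact ⟨M.orig t, rfl, (hχ Act M σ σ' hσ _ _ (hs.snoc (hσ i) t)).1 h⟩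
    · rintro ⟨⟨⟨t, b⟩, hb⟩, (rfl : b = false), h⟩
      exact ⟨t, (hχ Act M σ σ' hσ _ _ (hs.snoc (hσ i) t)).2 h⟩
  | @body l ψ =>
    refine ⟨ψ.map (Prod.map Sum.inl id), fun Act _ M σ σ' hσ s s' hs => ?_⟩
    change satSync M l ψ s ↔ satSync M.unroll l (ψ.map (Prod.map Sum.inl id)) s'
    have h := DTMC.Bisim.compose (D := fun i => M.inducedSync (s i).1)
      (E := fun i => (M.unroll.inducedSync (s' i).1).relabel Sum.inl)
      (x := fun i => ((s i).1.init (s i).2, (s i).2))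
      (y := fun i => ((s' i).1.init (s' i).2, (s' i).2)) fun i => by
        have := (hs i).1 (s i).2
        rw [← (hs i).2] at this
        exact this
    exact (h.sat_iff ψ).trans (Fml.sat_map (Prod.map Sum.inl id)
      (DTMC.compose fun i => M.unroll.inducedSync (s' i).1) ψ _).symm

theorem exists_replaceBody_schedQ [Nonempty S] {m : ℕ} (φ : SchedQ (fun l => Fml Ops (AP × Fin l)) m) :
    ∃ χ : Fml Ops ((AP ⊕ (S × Bool)) × Fin φ.numState),
      ∀ (Act : Type) [Fintype Act] (M : MDP AP S Act) (σ : Fin m → Scheduler M)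
        (σ' : Fin m → Scheduler M.unroll), (∀ i, M.SchedRel (σ i) (σ' i)) →
        (φ.Sat (satSync M) σ ↔
          (φ.replaceBody (B' := fun l => Fml Ops ((AP ⊕ (S × Bool)) × Fin l)) χ).Sat
            (satSync M.unroll) σ') := by
  have snoc : ∀ {m : ℕ} {Act : Type} [Fintype Act] {M : MDP AP S Act} {σ : Fin m → Scheduler M}
      {σ' : Fin m → Scheduler M.unroll}, (∀ i, M.SchedRel (σ i) (σ' i)) →
      ∀ {ρ ρ'}, M.SchedRel ρ ρ' → ∀ i, M.SchedRel (Fin.snoc (α := fun _ => Scheduler M) σ ρ i)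
        (Fin.snoc (α := fun _ => Scheduler M.unroll) σ' ρ' i) := by
    intro m Act _ M σ σ' hσ ρ ρ' hρ
    refine Fin.lastCases ?_ fun j => ?_
    · rw [Fin.snoc_last, Fin.snoc_last]; exact hρ
    · rw [Fin.snoc_castSucc, Fin.snoc_castSucc]; exact hσ j
  induction φ with
  | all φ ih =>
    obtain ⟨χ, hχ⟩ := ih
    refine ⟨χ, fun Act _ M σ σ' hσ => ⟨fun h ρ => ?_, fun h ρ => ?_⟩⟩
    · exact (hχ Act M _ _ (snoc hσ (MDP.schedRel_foldSched ρ))).1 (h _)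
    · exact (hχ Act M _ _ (snoc hσ (MDP.schedRel_liftSched ρ))).2 (h _)
  | ex φ ih =>
    obtain ⟨χ, hχ⟩ := ih
    refine ⟨χ, fun Act _ M σ σ' hσ => ⟨?_, ?_⟩⟩
    · rintro ⟨ρ, h⟩
      exact ⟨_, (hχ Act M _ _ (snoc hσ (MDP.schedRel_liftSched ρ))).1 h⟩
    · rintro ⟨ρ, h⟩
      exact ⟨_, (hχ Act M _ _ (snoc hσ (MDP.schedRel_foldSched ρ))).2 h⟩
  | body φ =>
    obtain ⟨χ, hχ⟩ := exists_replaceBody_stateQ (S := S) φ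
    exact ⟨χ, fun Act _ M σ σ' hσ => hχ Act M σ σ' hσ _ _ fun j => j.elim0⟩

/-- A HyperPCTL formula can be translated to an AHyperPCTL formula over the transformed process. -/
theorem exists_aHyperPCTL [Nonempty S] (φ : HyperPCTL Ops AP) :
    ∃ χ : Fml Ops ((AP ⊕ (S × Bool)) × Fin φ.numState),
      ∀ (Act : Type) [Fintype Act] (M : MDP AP S Act),
        M.SatHyper φ ↔ M.unroll.SatAHyper (HyperPCTL.withStutter φ
          (Fml.imp (trivialStutter Ops AP S φ.numState) χ)) := by
  obtain ⟨χ, hχ⟩ := exists_replaceBody_schedQ (S := S) φ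
  exact ⟨χ, fun Act _ M => (hχ Act M _ _ fun i => i.elim0).trans (satAHyper_withStutter φ χ).symm⟩

end Relativize

/-! ### HyperPCTL cannot observe which action is taken -/

section Transfer

variable {Ops : Operators} {AP S₁ S₂ Act₁ Act₂ : Type} [Fintype S₁] [Fintype S₂] [Fintype Act₁]
  [Fintype Act₂] {M₁ : MDP AP S₁ Act₁} {M₂ : MDP AP S₂ Act₂}

/-- `e` respects labels, and transitions whatever the actions taken on the two sides; in particular
the transition probabilities of both processes do not depend on the action. -/
structure ActionFree (M₁ : MDP AP S₁ Act₁) (M₂ : MDP AP S₂ Act₂) (e : S₁ ≃ S₂) : Prop where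
  label : ∀ s, M₁.label s = M₂.label (e s)
  P : ∀ s α β t, M₁.P s α t = M₂.P (e s) β (e t)

theorem ActionFree.symm {e : S₁ ≃ S₂} (h : ActionFree M₁ M₂ e) : ActionFree M₂ M₁ e.symm where
  label s := by rw [h.label, e.apply_symm_apply]
  P s α β t := by rw [h.P _ β α, e.apply_symm_apply, e.apply_symm_apply]

/-- As actions do not matter, the modes of the scheduler can be kept and any enabled action be
chosen. -/
theorem ActionFree.exists_sched {e : S₁ ≃ S₂} (h : ActionFree M₁ M₂ e) (σ₁ : Scheduler M₁) :
    ∃ σ₂ : Scheduler M₂, ∀ s, DTMC.Bisim (M₁.inducedSync σ₁) (M₂.inducedSync σ₂)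
      (σ₁.init s, s) (σ₂.init (e s), e s) := by
  classical
  choose β hβ using M₂.exists_enabled
  let σ₂ : Scheduler M₂ :=
    { Q := σ₁.Q
      countable := σ₁.countable
      nonempty := σ₁.nonempty
      mode := fun q s => σ₁.mode q (e.symm s)
      init := fun s => σ₁.init (e.symm s)
      act := fun q s α => if α = β s then 1 else 0
      sum_act := fun q s => by simp
      act_disabled := fun q s α hα => if_neg fun (h' : α = β s) => hα (h' ▸ hβ s) }
  have hom : DTMC.IsHomOn (M₁.inducedSync σ₁) (M₂.inducedSync σ₂) (fun x => (x.1, e x.2))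
      Set.univ :=
    { closed := fun _ _ _ _ => trivial
      label := fun x _ => h.label x.2
      map_step := by
        rintro ⟨q, s⟩ -
        ext ⟨q', y⟩
        refine (M₁.map_inducedSync_step_apply σ₁ (q, s) (fun x => (x.1, e x.2)) (q', y)).trans ?_
        change _ = (ite (q' = σ₁.mode q (e.symm (e s)))
          ((∑ α, (if α = β (e s) then 1 else 0) * M₂.P (e s) α y : ℝ≥0) : ℝ≥0∞) 0)
        rw [e.symm_apply_apply]
        have h1 : ∑ α, (if α = β (e s) then 1 else 0) * M₂.P (e s) α y
            = ∑ α, σ₁.act q s α * M₁.P s α (e.symm y) := by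
          simp only [h.P s _ (β (e s)), e.apply_symm_apply, ← Finset.sum_mul, σ₁.sum_act]
          simp
        rw [h1]
        by_cases hq : q' = σ₁.mode q s
        · rw [if_pos hq]
          congr 1
          rw [Finset.sum_eq_single (e.symm y)]
          · exact if_pos (Prod.ext hq (e.apply_symm_apply y).symm)
          · exact fun t _ ht => if_neg fun h' => ht (by
              have : y = e t := congrArg Prod.snd h'
              rw [this, e.symm_apply_apply])
          · simp
        · rw [if_neg hq]
          simp only [ENNReal.coe_eq_zero]
          exact Finset.sum_eq_zero fun y _ => if_neg fun h => hq (congrArg Prod.fst h) }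
  refine ⟨σ₂, fun s => ?_⟩
  have := hom.bisim ((σ₁.init s, s) : σ₁.Q × S₁)
  have h2 : σ₂.init (e s) = σ₁.init s := congrArg σ₁.init (e.symm_apply_apply s)
  rw [h2]
  exact this

theorem StateQ.sat_iff_of_bisim (e : S₁ ≃ S₂) {m l : ℕ}
    (φ : StateQ (fun l => Fml Ops (AP × Fin l)) m l) {σ₁ : Fin m → Scheduler M₁}
    {σ₂ : Fin m → Scheduler M₂}
    (hσ : ∀ i s, DTMC.Bisim (M₁.inducedSync (σ₁ i)) (M₂.inducedSync (σ₂ i))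
      ((σ₁ i).init s, s) ((σ₂ i).init (e s), e s))
    {s₁ : Fin l → Scheduler M₁ × S₁} {s₂ : Fin l → Scheduler M₂ × S₂}
    (hs : ∀ j, DTMC.Bisim (M₁.inducedSync (s₁ j).1) (M₂.inducedSync (s₂ j).1)
      ((s₁ j).1.init (s₁ j).2, (s₁ j).2) ((s₂ j).1.init (s₂ j).2, (s₂ j).2)) :
    φ.Sat (satSync M₁) σ₁ s₁ ↔ φ.Sat (satSync M₂) σ₂ s₂ := by
  induction φ with
  | all i φ ih =>
    refine e.forall_congr fun t => ih (Fin.lastCases ?_ fun j => ?_)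
    · rw [Fin.snoc_last, Fin.snoc_last]; exact hσ i t
    · rw [Fin.snoc_castSucc, Fin.snoc_castSucc]; exact hs j
  | ex i φ ih =>
    refine e.exists_congr fun t => ih (Fin.lastCases ?_ fun j => ?_)
    · rw [Fin.snoc_last, Fin.snoc_last]; exact hσ i t
    · rw [Fin.snoc_castSucc, Fin.snoc_castSucc]; exact hs j
  | body ψ => exact (DTMC.Bisim.compose hs).sat_iff ψ

theorem ActionFree.schedQ_sat_iff {e : S₁ ≃ S₂} (h : ActionFree M₁ M₂ e) {m : ℕ}
    (φ : SchedQ (fun l => Fml Ops (AP × Fin l)) m) {σ₁ : Fin m → Scheduler M₁}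
    {σ₂ : Fin m → Scheduler M₂}
    (hσ : ∀ i s, DTMC.Bisim (M₁.inducedSync (σ₁ i)) (M₂.inducedSync (σ₂ i))
      ((σ₁ i).init s, s) ((σ₂ i).init (e s), e s)) :
    φ.Sat (satSync M₁) σ₁ ↔ φ.Sat (satSync M₂) σ₂ := by
  have h21 : ∀ ρ₂ : Scheduler M₂, ∃ ρ₁ : Scheduler M₁, ∀ s,
      DTMC.Bisim (M₁.inducedSync ρ₁) (M₂.inducedSync ρ₂)
        (ρ₁.init s, s) (ρ₂.init (e s), e s) := fun ρ₂ => by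
    obtain ⟨ρ₁, hρ⟩ := h.symm.exists_sched ρ₂
    refine ⟨ρ₁, fun s => ?_⟩
    have := (hρ (e s)).symm
    rwa [e.symm_apply_apply] at this
  have snoc : ∀ {m : ℕ} {σ₁ : Fin m → Scheduler M₁} {σ₂ : Fin m → Scheduler M₂},
      (∀ i s, DTMC.Bisim (M₁.inducedSync (σ₁ i)) (M₂.inducedSync (σ₂ i))
        ((σ₁ i).init s, s) ((σ₂ i).init (e s), e s)) →
      ∀ {ρ₁ ρ₂}, (∀ s, DTMC.Bisim (M₁.inducedSync ρ₁) (M₂.inducedSync ρ₂)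
        (ρ₁.init s, s) (ρ₂.init (e s), e s)) →
      ∀ i s, DTMC.Bisim (M₁.inducedSync (Fin.snoc (α := fun _ => Scheduler M₁) σ₁ ρ₁ i))
        (M₂.inducedSync (Fin.snoc (α := fun _ => Scheduler M₂) σ₂ ρ₂ i))
        ((Fin.snoc (α := fun _ => Scheduler M₁) σ₁ ρ₁ i).init s, s)
        ((Fin.snoc (α := fun _ => Scheduler M₂) σ₂ ρ₂ i).init (e s), e s) := by
    intro m σ₁ σ₂ hσ ρ₁ ρ₂ hρ
    refine Fin.lastCases ?_ fun j => ?_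
    · rw [Fin.snoc_last, Fin.snoc_last]; exact hρ
    · rw [Fin.snoc_castSucc, Fin.snoc_castSucc]; exact hσ j
  induction φ with
  | all φ ih =>
    constructor
    · intro H ρ₂
      obtain ⟨ρ₁, hρ⟩ := h21 ρ₂
      exact (ih (snoc hσ hρ)).1 (H ρ₁)
    · intro H ρ₁
      obtain ⟨ρ₂, hρ⟩ := h.exists_sched ρ₁
      exact (ih (snoc hσ hρ)).2 (H ρ₂)
  | ex φ ih =>
    constructor
    · rintro ⟨ρ₁, H⟩
      obtain ⟨ρ₂, hρ⟩ := h.exists_sched ρ₁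
      exact ⟨ρ₂, (ih (snoc hσ hρ)).1 H⟩
    · rintro ⟨ρ₂, H⟩
      obtain ⟨ρ₁, hρ⟩ := h21 ρ₂
      exact ⟨ρ₁, (ih (snoc hσ hρ)).2 H⟩
  | body φ => exact φ.sat_iff_of_bisim e hσ fun j => j.elim0

/-- HyperPCTL cannot distinguish between processes that differ only in the number of equivalent
actions. -/
theorem ActionFree.satHyper_iff {e : S₁ ≃ S₂} (h : ActionFree M₁ M₂ e) (φ : HyperPCTL Ops AP) :
    M₁.SatHyper φ ↔ M₂.SatHyper φ :=
  h.schedQ_sat_iff φ fun i => i.elim0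

end Transfer

/-! ### An AHyperPCTL formula that observes a random choice between actions -/

section Strictness

variable {Ops : Operators} {AP : Type}

/-- The process with two states, which alternates between them whatever the action; all labels
hold in `true` and none in `false`. -/
def flipMDP (AP Act : Type) [Fintype Act] [Nonempty Act] : MDP AP Bool Act where
  label s := {_a | s = true}
  P s _ t := if t = !s then 1 else 0
  exists_enabled _ := ⟨Classical.arbitrary Act, by simp⟩
  enabled_or_disabled _ _ := .inl (by simp)

theorem flipMDP_actionFree (Act₁ Act₂ : Type) [Fintype Act₁] [Nonempty Act₁] [Fintype Act₂]
    [Nonempty Act₂] :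
    ActionFree (flipMDP AP Act₁) (flipMDP AP Act₂) (Equiv.refl Bool) :=
  ⟨fun _ => rfl, fun _ _ _ _ => rfl⟩

theorem not_selfLoop_flipMDP (Act : Type) [Fintype Act] [Nonempty Act] (s : Bool) :
    ¬ (flipMDP AP Act).SelfLoop s := by
  rintro ⟨α, h⟩
  simp [flipMDP] at h

theorem flipMDP_unroll_actionFree (Act₁ Act₂ : Type) [Fintype Act₁] [Nonempty Act₁] [Fintype Act₂]
    [Nonempty Act₂] :
    ∃ e, ActionFree (flipMDP AP Act₁).unroll (flipMDP AP Act₂).unroll e := by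
  refine ⟨Equiv.subtypeEquivRight fun x => ?_, fun x => ?_, fun x α β y => ?_⟩
  · simp only [not_selfLoop_flipMDP]
  · rfl
  · rfl

/-- With `θ = (ℙ(○ a) = 0)`, the formula `θ ∧ ¬ ℙ(○ θ) = 0 ∧ ¬ ℙ(○ ¬θ) = 0`. Only the support of the
transition function matters for it. -/
def coinBody (Ops : Operators) {AP : Type} (a : AP) : Fml Ops (AP × Fin 1) :=
  .and (.nextNull (.atom (a, 0)))
    (.and (.neg (.nextNull (.nextNull (.atom (a, 0)))))
      (.neg (.nextNull (.neg (.nextNull (.atom (a, 0)))))))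

/-- The formula `∃ σ̂. ∃ ŝ(σ̂). ∃ τ̂(ŝ).` followed by `coinBody`: the experiment surely does not reach
`a` next, but whether it may do so in the second step depends on a random event in the first. -/
def coinFormula (Ops : Operators) {AP : Type} (a : AP) : AHyperPCTL Ops AP :=
  .ex (.body (.ex 0 (.body (.ex 0 (.body (coinBody Ops a))))))

/-- No successor of `x` in `D` has the label `a`. -/
def NoSuccLabel (D : DTMC AP) (a : AP) (x : D.State) : Prop :=
  ∀ y, D.step x y ≠ 0 → a ∉ D.label y

theorem sat_coinBody (D : DTMC AP) (a : AP) (x : D.State) :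
    (coinBody Ops a).Sat (DTMC.compose fun _ : Fin 1 => D) (fun _ => x) ↔
      NoSuccLabel D a x ∧ (∃ y, D.step x y ≠ 0 ∧ NoSuccLabel D a y) ∧
        ∃ y, D.step x y ≠ 0 ∧ ¬ NoSuccLabel D a y := by
  have hstep : ∀ x y : Fin 1 → D.State, (DTMC.compose fun _ : Fin 1 => D).step x y ≠ 0 ↔
      D.step (x 0) (y 0) ≠ 0 := fun x y =>
    DTMC.compose_step_ne_zero.trans Fin.forall_fin_one
  have hall : ∀ (x : Fin 1 → D.State) (p : D.State → Prop),
      (∀ y : Fin 1 → D.State, (DTMC.compose fun _ : Fin 1 => D).step x y ≠ 0 → p (y 0)) ↔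
        ∀ y, D.step (x 0) y ≠ 0 → p y := fun x p =>
    ⟨fun h y hy => h (fun _ => y) ((hstep _ _).2 hy), fun h y hy => h _ ((hstep _ _).1 hy)⟩
  have hA : ∀ x : Fin 1 → D.State,
      (Fml.nextNull (.atom (a, 0)) : Fml Ops (AP × Fin 1)).Sat (DTMC.compose fun _ : Fin 1 => D) x
        ↔ NoSuccLabel D a (x 0) := fun x => by
    refine (Fml.sat_nextNull _ _ _).trans (Iff.trans ?_ (hall x fun y => a ∉ D.label y))
    simp only [Fml.Sat]
    exact Iff.rfl
  have h1 := (Fml.sat_nextNull (DTMC.compose fun _ : Fin 1 => D)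
    (Fml.nextNull (.atom (a, 0)) : Fml Ops (AP × Fin 1)) (fun _ => x)).trans
    ((forall₂_congr fun y _ => not_congr (hA y)).trans
      (hall (fun _ => x) fun y => ¬ NoSuccLabel D a y))
  have h2 := (Fml.sat_nextNull (DTMC.compose fun _ : Fin 1 => D)
    (.neg (Fml.nextNull (.atom (a, 0))) : Fml Ops (AP × Fin 1)) (fun _ => x)).trans
    ((forall₂_congr fun y _ => not_congr ((by simp only [Fml.Sat] :
      (Fml.neg (Fml.nextNull (.atom (a, 0))) : Fml Ops (AP × Fin 1)).Sat
        (DTMC.compose fun _ : Fin 1 => D) y ↔ _).trans (not_congr (hA y)))).trans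
      (hall (fun _ => x) fun y => ¬¬ NoSuccLabel D a y))
  simp only [coinBody, Fml.Sat]
  refine and_congr (hA _) (and_congr ((not_congr h1).trans ?_) ((not_congr h2).trans ?_))
  · push Not; rfl
  · push Not; rfl

theorem satAHyper_coinFormula {S Act : Type} [Fintype S] [Fintype Act] (M : MDP AP S Act) (a : AP) :
    M.SatAHyper (coinFormula Ops a) ↔ ∃ (σ : Scheduler M) (s : S) (τ : StutterScheduler M),
      τ.Fair σ ∧ (coinBody Ops a).Sat (DTMC.compose fun _ : Fin 1 => M.induced σ τ)
        (fun _ => (σ.init s, τ.init s, s)) := by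
  simp only [MDP.SatAHyper, coinFormula, SchedQ.Sat, StateQ.Sat, StutterQ.Sat]
  refine exists_congr fun σ => exists_congr fun s => exists_congr fun τ => and_congr Iff.rfl ?_
  have key : ∀ x : Fin 1 → Experiment M, x = (fun _ => ⟨σ, τ, s⟩) →
      ((coinBody Ops a).Sat (DTMC.compose fun k => M.induced (x k).sched (x k).stutter)
        (fun k => ((x k).sched.init (x k).start, (x k).stutter.init (x k).start, (x k).start)) ↔
      (coinBody Ops a).Sat (DTMC.compose fun _ : Fin 1 => M.induced σ τ)
        (fun _ => (σ.init s, τ.init s, s))) := by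
    rintro _ rfl
    rfl
  exact key _ (funext fun i => by
    rw [Subsingleton.elim (α := Fin 1) i (Fin.last 0), Fin.snoc_last]
    rfl)

/-- With a single action, a stutter-scheduler is deterministic apart from the choice between
stuttering and proceeding; if all successors have the same state, there is only one. -/
theorem not_satAHyper_coinFormula (a : AP) :
    ¬ (flipMDP AP Unit).SatAHyper (coinFormula Ops a) := by
  rw [satAHyper_coinFormula]
  rintro ⟨σ, s, τ, -, h⟩
  obtain ⟨h1, ⟨y, hy, hy'⟩, z, hz, hz'⟩ := (sat_coinBody _ a _).1 h
  have key : ∀ y : MDP.Config σ τ,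
      ((flipMDP AP Unit).induced σ τ).step (σ.init s, τ.init s, s) y ≠ 0 → ¬ y.2.2 = true →
      y = (if s = true then σ.mode (σ.init s) s else σ.init s, τ.mode (τ.init s) s (), false) := by
    rintro ⟨q, e, t⟩ hy ht
    obtain rfl : t = false := by simpa using ht
    rcases MDP.induced_step_ne_zero.1 hy with h | h
    · obtain ⟨rfl, (rfl : false = s), -, rfl, -⟩ := MDP.jointWeight_stutter_ne_zero.1 h
      simp
    · obtain ⟨rfl, _, rfl, -, -, hP⟩ := MDP.jointWeight_proceed_ne_zero.1 h
      obtain rfl : s = true := by simpa [flipMDP] using hP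
      simp
  exact hz' ((key y hy (h1 y hy)).trans (key z hz (h1 z hz)).symm ▸ hy')

/-- The stutter-scheduler that stutters in the first step and remembers the action that was chosen;
if this was `false`, it stutters once more. Then it never stutters again. -/
def coinStutter (AP : Type) : StutterScheduler (flipMDP AP Bool) where
  Q := Option Bool
  countable := inferInstance
  nonempty := inferInstance
  mode q _ α := match q with
    | none => some α
    | some _ => some true
  init _ := none
  act q _ _ c := if c = .proceed ↔ q = some true then 1 else 0
  sum_act q _ _ := by by_cases h : q = some true <;> simp [h]

/-- The scheduler that always chooses uniformly between the two actions. -/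
noncomputable def coinSched (AP : Type) : Scheduler (flipMDP AP Bool) where
  Q := Unit
  countable := inferInstance
  nonempty := inferInstance
  mode _ _ := ()
  init _ := ()
  act _ _ _ := 1 / 2
  sum_act _ _ := by simp
  act_disabled _ s α h := absurd (by simp [MDP.enabled, flipMDP]) h

theorem coinStutter_fair : (coinStutter AP).Fair (coinSched AP) := by
  intro s
  refine measure_eq_zero_iff_ae_notMem.2 ?_
  filter_upwards [((flipMDP AP Bool).recorded (coinSched AP) (coinStutter AP)).ae_step_ne_zero _]
    with π hπ
  rintro ⟨N, hN⟩
  have hst : ∀ n ≥ N, ∃ α, (coinStutter AP).mode (π n).2.2.1 (π n).2.2.2 α = (π (n + 1)).2.2.1 ∧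
      (coinStutter AP).act (π n).2.2.1 (π n).2.2.2 α .stutter ≠ 0 := fun n hn => by
    have h1 := MDP.recorded_step_ne_zero.1 (hπ n)
    have h2 : π (n + 1) = (.stutter, (π (n + 1)).2) := Prod.ext (hN (n + 1) (by omega)) rfl
    rw [h2] at h1
    obtain ⟨-, -, α, h3, -, h4⟩ := MDP.jointWeight_stutter_ne_zero.1 h1
    exact ⟨α, h3, h4⟩
  -- Two steps later the mode is `some true`, which forbids stuttering.
  obtain ⟨α, h0, -⟩ := hst N le_rfl
  obtain ⟨β, h1, -⟩ := hst (N + 1) (by omega)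
  obtain ⟨γ, -, h2⟩ := hst (N + 2) (by omega)
  have h3 : (π (N + 2)).2.2.1 = some true := by
    have h3 : ∀ q s t, (coinStutter AP).mode ((coinStutter AP).mode q s α) t β = some true := by
      rintro (_ | _) _ _ <;> rfl
    rw [← h1, ← h0]
    exact h3 _ _ _
  rw [h3] at h2
  exact h2 (by simp [coinStutter])

/-- With two actions, the stutter-scheduler can remember which of them was chosen at random. -/
theorem satAHyper_coinFormula_flipMDP (a : AP) :
    (flipMDP AP Bool).SatAHyper (coinFormula Ops a) := by
  rw [satAHyper_coinFormula]
  refine ⟨coinSched AP, false, coinStutter AP, coinStutter_fair, (sat_coinBody _ a _).2 ?_⟩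
  have first : ∀ b : Bool, ((flipMDP AP Bool).induced (coinSched AP) (coinStutter AP)).step
      ((), none, false) ((), some b, false) ≠ 0 := fun b =>
    MDP.induced_step_ne_zero.2 <| .inl <| MDP.jointWeight_stutter_ne_zero.2
      ⟨rfl, rfl, b, rfl, by simp [coinSched], by simp [coinStutter]⟩
  -- A proceeding step from `false` leads to `true`; only the mode `some true` proceeds there.
  have noSucc : ∀ q : Option Bool, q ≠ some true → NoSuccLabel
      ((flipMDP AP Bool).induced (coinSched AP) (coinStutter AP)) a ((), q, false) := by
    rintro q hq ⟨_, _, t⟩ hy (ht : t = true)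
    rcases MDP.induced_step_ne_zero.1 hy with h | h
    · obtain ⟨-, h, -⟩ := MDP.jointWeight_stutter_ne_zero.1 h
      exact Bool.false_ne_true (h.symm.trans ht)
    · obtain ⟨-, α, -, -, h, -⟩ := MDP.jointWeight_proceed_ne_zero.1 h
      exact absurd (by simp [coinStutter, hq]) h
  refine ⟨noSucc none (by simp), ⟨_, first false, noSucc _ (by simp)⟩, _, first true, fun h => ?_⟩
  refine h ((), some true, true) ?_ rfl
  exact MDP.induced_step_ne_zero.2 <| .inr <| MDP.jointWeight_proceed_ne_zero.2
    ⟨rfl, false, rfl, by simp [coinSched], by simp [coinStutter], by simp [flipMDP]⟩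

end Strictness

end HyperLogic


theorem mainTheorem2 (Ops : Operators) (AP : Type) :
    (∀ (S : Type) [Fintype S] [Nonempty S] (φ : HyperPCTL Ops AP),
      ∃ χ : Fml Ops ((AP ⊕ (S × Bool)) × Fin φ.numState),
        ∀ (Act : Type) [Fintype Act] (M : MDP AP S Act),
          M.SatHyper φ ↔
            M.unroll.SatAHyper (HyperPCTL.withStutter φ
              (Fml.imp (trivialStutter Ops AP S φ.numState) χ))) ∧
    (Nonempty AP →
      ∃ (S : Type) (_ : Fintype S) (_ : Nonempty S) (ψ : AHyperPCTL Ops AP),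
        (¬ ∃ φ : HyperPCTL Ops AP,
          ∀ (Act : Type) [Fintype Act] (M : MDP AP S Act),
            M.SatAHyper ψ ↔ M.SatHyper φ) ∧
        (¬ ∃ φ : HyperPCTL Ops (AP ⊕ (S × Bool)),
          ∀ (Act : Type) [Fintype Act] (M : MDP AP S Act),
            M.SatAHyper ψ ↔ M.unroll.SatHyper φ)) := by
  refine ⟨fun S _ _ φ => exists_aHyperPCTL φ, fun ⟨a⟩ =>
    ⟨Bool, inferInstance, inferInstance, coinFormula Ops a, ?_, ?_⟩⟩
  · rintro ⟨φ, h⟩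
    exact not_satAHyper_coinFormula a ((h _ _).2
      (((flipMDP_actionFree Unit Bool).satHyper_iff φ).2
        ((h _ _).1 (satAHyper_coinFormula_flipMDP a))))
  · rintro ⟨φ, h⟩
    obtain ⟨e, he⟩ := flipMDP_unroll_actionFree (AP := AP) Unit Bool
    exact not_satAHyper_coinFormula a ((h _ _).2
      ((he.satHyper_iff φ).2 ((h _ _).1 (satAHyper_coinFormula_flipMDP a))))
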